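/- Let $\mathcal H$ be a complex Hilbert space, let $\mathbf L_2(\mathbb R)\otimes\mathcal H=\mathbf L_2(\mathbb R;\mathcal H)$, and let $\mathbf L(\mathcal H)$ be the space of bounded linear operators on $\mathcal H$. For $h\in\mathbb R$ let $(T_hf)(t)=f(t+h)$, and let $U$ be the unitary Fourier transform on $\mathbf L_2(\mathbb R)\otimes\mathcal H$, $Uf(t)=\frac1{\sqrt{2\pi}}\int_{\mathbb R}f(x)e^{ixt}\,dx$. Let $\mathbf H_2(\mathbb C_+)\otimes\mathcal H$ be the Hardy space of the open upper half-plane $\mathbb C_+$, that is, the space of holomorphic functions $F:\mathbb C_+\to\mathcal H$ with $\sup_{y>0}\int_{\mathbb R}\|F(x+iy)\|^2dx<\infty$ that have a boundary value $f\in\mathbf L_2(\mathbb R)\otimes\mathcal H$, i.e. $F(\cdot+iy)\to f$ in $\mathbf L_2$ as $y\downarrow0$; such $F$ is identified with $f$, so that $\mathbf H_2(\mathbb C_+)\otimes\mathcal H$ is a subspace of $\mathbf L_2(\mathbb R)\otimes\mathcal H$. Let $X$ be a bounded linear operator from $\mathbf L_2(\mathbb R)\otimes\mathcal H$ into itself which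 commutes with all the translations $T_h$, $h\in\mathbb R$, and assume that $$UXU^{-1}\big(\mathbf H_2(\mathbb C_+)\otimes\mathcal H\big)\subset\mathbf H_2(\mathbb C_+)\otimes\mathcal H.$$ Then there exists an $\mathbf L(\mathcal H)$-valued function $S$ on the closed upper half-plane $\{\operatorname{Im}\lambda\ge0\}$, bounded in norm and analytic in $\mathbb C_+$, such that $UXU^{-1}$ acts on $\mathbf H_2(\mathbb C_+)\otimes\mathcal H$ as multiplication by $S$: for every $f\in\mathbf H_2(\mathbb C_+)\otimes\mathcal H$, $$(UXU^{-1}f)(\lambda)=S(\lambda)f(\lambda)\quad\text{for all }\lambda\in\mathbb C_+,\qquad (UXU^{-1}f)(t)=S(t)f(t)\quad\text{for almost every }t\in\mathbb R.$$ -/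

import Mathlib

open MeasureTheory Filter Topology

noncomputable section

/-- The space `L²(ℝ) ⊗ H`, realised as the space of (classes of) square integrable functions from
`ℝ`, with Lebesgue measure, to the Hilbert space `H`. -/
abbrev L2Space (H : Type*) [NormedAddCommGroup H] : Type _ :=
  Lp H 2 (volume : Measure ℝ)

/-- The translation operator `(T_h f)(t) = f (t + h)` on `L²(ℝ) ⊗ H`. -/
def translation {H : Type*} [NormedAddCommGroup H] [InnerProductSpace ℂ H] (h : ℝ) :
    L2Space H →ₗᵢ[ℂ] L2Space H :=
  Lp.compMeasurePreservingₗᵢ ℂ (fun t : ℝ => t + h) (measurePreserving_add_right volume h)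

theorem eLpNorm_comp_mul_left {H : Type*} [NormedAddCommGroup H] (a : ℝ) (ha : a ≠ 0)
    (f : ℝ → H) :
    eLpNorm (fun t => f (a * t)) 2 volume =
      ENNReal.ofReal |a⁻¹| ^ (2⁻¹ : ℝ) * eLpNorm f 2 volume := by
  have he : MeasurableEmbedding (fun t : ℝ => a * t) :=
    (Homeomorph.mulLeft₀ a ha).measurableEmbedding
  have h1 := he.eLpNorm_map_measure (μ := (volume : Measure ℝ)) (g := f) (p := 2)
  rw [Real.map_volume_mul_left ha, eLpNorm_smul_measure_of_ne_top (by norm_num)] at h1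
  simpa [Function.comp_def] using h1.symm

theorem quasiMeasurePreserving_mul_left_real (a : ℝ) (ha : a ≠ 0) :
    Measure.QuasiMeasurePreserving (fun t : ℝ => a * t) volume volume := by
  refine ⟨by fun_prop, ?_⟩
  rw [Real.map_volume_mul_left ha]
  exact Measure.AbsolutelyContinuous.rfl.smul_left _

theorem memLp_comp_mul_left {H : Type*} [NormedAddCommGroup H] (a : ℝ) (ha : a ≠ 0)
    {f : ℝ → H} (hf : MemLp f 2 volume) : MemLp (fun t => f (a * t)) 2 volume := by
  refine ⟨hf.1.comp_quasiMeasurePreserving (quasiMeasurePreserving_mul_left_real a ha), ?_⟩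
  rw [eLpNorm_comp_mul_left a ha]
  exact ENNReal.mul_lt_top (ENNReal.rpow_lt_top_of_nonneg (by norm_num) (by simp)) hf.2

theorem ae_comp_mul_left (a : ℝ) (ha : a ≠ 0) {p : ℝ → Prop} (hp : ∀ᵐ t : ℝ, p t) :
    ∀ᵐ t : ℝ, p (a * t) :=
  (quasiMeasurePreserving_mul_left_real a ha).ae hp

/-- The unitary dilation `f ↦ (t ↦ |a|^{1/2} f (a t))` of `L²(ℝ) ⊗ H`, as a linear map. -/
def dilationLM (H : Type*) [NormedAddCommGroup H] [InnerProductSpace ℂ H] (a : ℝ) (ha : a ≠ 0) :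
    L2Space H →ₗ[ℂ] L2Space H where
  toFun f := ((memLp_comp_mul_left a ha (Lp.memLp f)).const_smul
    ((√|a| : ℝ) : ℂ)).toLp (fun t => ((√|a| : ℝ) : ℂ) • f (a * t))
  map_add' f g := by
    rw [← MemLp.toLp_add]
    refine MemLp.toLp_congr _ _ ?_
    filter_upwards [ae_comp_mul_left a ha (Lp.coeFn_add f g)] with t ht
    rw [Pi.add_apply, ht, Pi.add_apply, smul_add]
  map_smul' c f := by
    rw [RingHom.id_apply, ← MemLp.toLp_const_smul]
    refine MemLp.toLp_congr _ _ ?_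
    filter_upwards [ae_comp_mul_left a ha (Lp.coeFn_smul c f)] with t ht
    rw [Pi.smul_apply, ht, Pi.smul_apply, smul_comm]

theorem coeFn_dilationLM {H : Type*} [NormedAddCommGroup H] [InnerProductSpace ℂ H] (a : ℝ)
    (ha : a ≠ 0) (f : L2Space H) :
    dilationLM H a ha f =ᵐ[volume] fun t => ((√|a| : ℝ) : ℂ) • f (a * t) :=
  MemLp.coeFn_toLp ((memLp_comp_mul_left a ha (Lp.memLp f)).const_smul ((√|a| : ℝ) : ℂ))

theorem norm_dilationLM {H : Type*} [NormedAddCommGroup H] [InnerProductSpace ℂ H] (a : ℝ)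
    (ha : a ≠ 0) (f : L2Space H) : ‖dilationLM H a ha f‖ = ‖f‖ := by
  have h0 : 0 < |a| := abs_pos.2 ha
  have h2 : √|a| * |a|⁻¹ ^ (2⁻¹ : ℝ) = 1 := by
    rw [Real.sqrt_eq_rpow, one_div, ← Real.mul_rpow h0.le (inv_nonneg.2 h0.le),
      mul_inv_cancel₀ h0.ne', Real.one_rpow]
  rw [Lp.norm_def, Lp.norm_def, eLpNorm_congr_ae (coeFn_dilationLM a ha f),
    show (fun t => ((√|a| : ℝ) : ℂ) • f (a * t)) = ((√|a| : ℝ) : ℂ) • fun t => f (a * t) from rfl,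
    eLpNorm_const_smul, eLpNorm_comp_mul_left a ha, ENNReal.toReal_mul, ENNReal.toReal_mul,
    ← mul_assoc, ← ENNReal.toReal_rpow, ENNReal.toReal_ofReal (abs_nonneg _), abs_inv]
  have h3 : ‖((√|a| : ℝ) : ℂ)‖ₑ.toReal = √|a| := by
    simp
  rw [h3, h2, one_mul]

theorem dilationLM_dilationLM {H : Type*} [NormedAddCommGroup H] [InnerProductSpace ℂ H] (a b : ℝ)
    (ha : a ≠ 0) (hb : b ≠ 0) (hab : b * a = 1) (f : L2Space H) :
    dilationLM H a ha (dilationLM H b hb f) = f := by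
  apply Lp.ext
  filter_upwards [coeFn_dilationLM a ha (dilationLM H b hb f),
    ae_comp_mul_left a ha (coeFn_dilationLM b hb f)] with t h1 h2
  have h3 : √|a| * √|b| = 1 := by
    rw [← Real.sqrt_mul (abs_nonneg a), ← abs_mul, mul_comm, hab]; simp
  rw [h1, h2, smul_smul, ← Complex.ofReal_mul, h3, ← mul_assoc, hab]
  simp

/-- The unitary dilation `f ↦ (t ↦ |a|^{1/2} f (a t))` of `L²(ℝ) ⊗ H`. -/
def dilation (H : Type*) [NormedAddCommGroup H] [InnerProductSpace ℂ H] (a : ℝ) (ha : a ≠ 0) :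
    L2Space H ≃ₗᵢ[ℂ] L2Space H where
  toLinearEquiv := LinearEquiv.ofLinearMap (dilationLM H a ha) (dilationLM H a⁻¹ (inv_ne_zero ha))
    (LinearMap.ext fun f => dilationLM_dilationLM a a⁻¹ ha (inv_ne_zero ha) (inv_mul_cancel₀ ha) f)
    (LinearMap.ext fun f => dilationLM_dilationLM a⁻¹ a (inv_ne_zero ha) ha (mul_inv_cancel₀ ha) f)
  norm_map' f := norm_dilationLM a ha f

theorem neg_inv_two_pi_ne_zero : -(2 * Real.pi)⁻¹ ≠ 0 :=
  neg_ne_zero.2 (inv_ne_zero (by positivity))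

/-- The unitary Fourier transform `(U f)(t) = (2π)^{-1/2} ∫ f(x) e^{ixt} dx` on `L²(ℝ) ⊗ H`.
In terms of Mathlib's `(𝓕 f)(ξ) = ∫ f(x) e^{-2πixξ} dx` it is
`(U f)(t) = (2π)^{-1/2} (𝓕 f)(-t / 2π)`; see `fourierU_toLp` for the integral formula. -/
def fourierU (H : Type*) [NormedAddCommGroup H] [InnerProductSpace ℂ H] [CompleteSpace H] :
    L2Space H ≃ₗᵢ[ℂ] L2Space H :=
  (Lp.fourierTransformₗᵢ ℝ H).trans (dilation H (-(2 * Real.pi)⁻¹) neg_inv_two_pi_ne_zero)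

/-- On the (dense) Schwartz functions, `fourierU` is given by the integral. -/
theorem fourierU_toLp {H : Type*} [NormedAddCommGroup H] [InnerProductSpace ℂ H] [CompleteSpace H]
    (f : SchwartzMap ℝ H) :
    fourierU H (f.toLp 2) =ᵐ[volume] fun t : ℝ =>
      ((1 / √(2 * Real.pi) : ℝ) : ℂ) • ∫ x : ℝ, Complex.exp (Complex.I * x * t) • f x := by
  have h1 : fourierU H (f.toLp 2) = dilationLM H (-(2 * Real.pi)⁻¹) neg_inv_two_pi_ne_zero
      ((FourierTransform.fourier f : SchwartzMap ℝ H).toLp 2) := by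
    rw [← SchwartzMap.toLp_fourier_eq]; rfl
  rw [h1]
  filter_upwards [coeFn_dilationLM _ neg_inv_two_pi_ne_zero
      ((FourierTransform.fourier f : SchwartzMap ℝ H).toLp 2),
    ae_comp_mul_left _ neg_inv_two_pi_ne_zero
      ((FourierTransform.fourier f : SchwartzMap ℝ H).coeFn_toLp 2 volume)] with t h2 h3
  have hpi : (0 : ℝ) < 2 * Real.pi := by positivity
  rw [h2, h3, SchwartzMap.fourier_coe, Real.fourier_eq' ]
  congr 1
  · rw [abs_neg, abs_of_pos (inv_pos.2 hpi), Real.sqrt_inv, one_div]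
  · refine integral_congr_ae (Eventually.of_forall fun x => ?_)
    simp only
    congr 2
    have : (Real.pi : ℂ) ≠ 0 := by exact_mod_cast Real.pi_ne_zero
    simp only [RCLike.inner_apply, conj_trivial]
    push_cast
    field_simp

/-- The open upper half-plane `ℂ₊`. -/
def upperHalf : Set ℂ := {z | 0 < z.im}

/-- `F` is a function in the `H`-valued Hardy space of the open upper half-plane (holomorphic in
`ℂ₊` with `sup_{y > 0} ∫ ‖F(x + iy)‖² dx < ∞`), and `f ∈ L²(ℝ) ⊗ H` is its boundary value, that
is, the `L²`-limit of `F(· + iy)` as `y ↓ 0`. -/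
structure IsHardyExtension {H : Type*} [NormedAddCommGroup H] [InnerProductSpace ℂ H]
    (F : ℂ → H) (f : L2Space H) : Prop where
  differentiableOn : DifferentiableOn ℂ F upperHalf
  bounded : ∃ M : NNReal, ∀ y : ℝ, 0 < y →
    eLpNorm (fun x : ℝ => F (x + y * Complex.I)) 2 volume ≤ M
  tendsto : Tendsto (fun y : ℝ => eLpNorm (fun x : ℝ => F (x + y * Complex.I) - f x) 2 volume)
    (𝓝[>] 0) (𝓝 0)

theorem aestronglyMeasurable_line {H : Type*} [NormedAddCommGroup H] [InnerProductSpace ℂ H]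
    {F : ℂ → H} (hF : DifferentiableOn ℂ F upperHalf) {y : ℝ} (hy : 0 < y) :
    AEStronglyMeasurable (fun x : ℝ => F (x + y * Complex.I)) volume := by
  refine Continuous.aestronglyMeasurable ?_
  refine hF.continuousOn.comp_continuous (by fun_prop) fun x => ?_
  simpa [upperHalf] using hy

theorem IsHardyExtension.add {H : Type*} [NormedAddCommGroup H] [InnerProductSpace ℂ H]
    {F G : ℂ → H} {f g : L2Space H} (hF : IsHardyExtension F f) (hG : IsHardyExtension G g) :
    IsHardyExtension (F + G) (f + g) := by
  obtain ⟨M, hM⟩ := hF.bounded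
  obtain ⟨N, hN⟩ := hG.bounded
  refine ⟨hF.1.add hG.1, ⟨M + N, fun y hy => ?_⟩, ?_⟩
  · have := eLpNorm_add_le (p := 2) (aestronglyMeasurable_line hF.1 hy)
      (aestronglyMeasurable_line hG.1 hy) (by norm_num)
    push_cast
    exact this.trans (add_le_add (hM y hy) (hN y hy))
  · have hlim := hF.tendsto.add hG.tendsto
    rw [add_zero] at hlim
    refine tendsto_of_tendsto_of_tendsto_of_le_of_le' tendsto_const_nhds hlim
      (Eventually.of_forall fun _ => zero_le) ?_
    filter_upwards [self_mem_nhdsWithin] with y hy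
    refine le_trans (le_of_eq ?_) (eLpNorm_add_le (p := 2)
      ((aestronglyMeasurable_line hF.1 hy).sub (Lp.aestronglyMeasurable f))
      ((aestronglyMeasurable_line hG.1 hy).sub (Lp.aestronglyMeasurable g)) (by norm_num))
    refine eLpNorm_congr_ae ?_
    filter_upwards [Lp.coeFn_add f g] with x hx
    simp only [Pi.add_apply]
    rw [hx, Pi.add_apply]
    abel

theorem IsHardyExtension.smul {H : Type*} [NormedAddCommGroup H] [InnerProductSpace ℂ H]
    {F : ℂ → H} {f : L2Space H} (c : ℂ) (hF : IsHardyExtension F f) :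
    IsHardyExtension (c • F) (c • f) := by
  obtain ⟨M, hM⟩ := hF.bounded
  refine ⟨hF.1.const_smul c, ⟨‖c‖₊ * M, fun y hy => ?_⟩, ?_⟩
  · have := eLpNorm_const_smul c (fun x : ℝ => F (x + y * Complex.I)) 2 volume
    push_cast
    exact this.le.trans (mul_le_mul_right (hM y hy) _)
  · have hlim := ENNReal.Tendsto.const_mul (a := ‖c‖ₑ) hF.tendsto (Or.inr enorm_ne_top)
    rw [mul_zero] at hlim
    refine hlim.congr fun y => ?_
    rw [← eLpNorm_const_smul]
    refine eLpNorm_congr_ae ?_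
    filter_upwards [Lp.coeFn_smul c f] with x hx
    rw [Pi.smul_apply, hx, smul_sub, Pi.smul_apply, Pi.smul_apply]

/-- The Hardy space `H₂(ℂ₊) ⊗ H`, as the subspace of `L²(ℝ) ⊗ H` of boundary values. -/
def hardySpace (H : Type*) [NormedAddCommGroup H] [InnerProductSpace ℂ H] :
    Submodule ℂ (L2Space H) where
  carrier := {f | ∃ F : ℂ → H, IsHardyExtension F f}
  add_mem' := by
    rintro f g ⟨F, hF⟩ ⟨G, hG⟩
    exact ⟨F + G, hF.add hG⟩
  zero_mem' := by
    refine ⟨0, differentiableOn_const 0, ⟨0, fun y _ => by simp⟩, ?_⟩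
    refine tendsto_const_nhds.congr fun y => ?_
    rw [← eLpNorm_zero (p := 2) (μ := (volume : Measure ℝ)) (ε := H)]
    refine eLpNorm_congr_ae ?_
    filter_upwards [Lp.coeFn_zero H 2 (volume : Measure ℝ)] with x hx
    simp
  smul_mem' := by
    rintro c f ⟨F, hF⟩
    exact ⟨c • F, hF.smul c⟩

end

/-! Since `U` turns translations into multiplications by e^{iht} (`fourierU_translation`), the
operator Y = U X U⁻¹ commutes with all modulations. The symbol is then built separately on the real
line and in the open half-plane; no boundary limit of the operators S(z) is taken.

On the line, uniqueness of the Fourier transform makes Y commute with every bounded scalar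
multiplier (`ae_eq_smul_of_commute_modulation`), so Y acts locally. Compressing Y to functions
constant on a small ball gives operators on H of norm at most ‖Y‖, and Lebesgue differentiation
gives their limit on each fixed vector, almost everywhere. H need not be separable, so the null set
depends on the vector. `exists_operator_of_tendsto` therefore defines S(t) at every t, extending
whatever strong limit exists there; each f then has its own null set
(`exists_multiplier_of_commute_modulation`).

In the half-plane the key is that zeros are preserved (`IsHardyExtension.apply_eq_zero`). If F(z) =
0, then multiplication by (w - ζ)/(w - z) keeps F in the Hardy space and is a bounded multiplier on
the line, so it commutes with Y; undoing it on the image produces a zero at z. Hence the value at z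
of the image depends only on F(z), and testing on Cauchy kernels with pole in the lower half-plane
gives the formula `hardySymbol`. It is analytic because z ↦ (t - z)⁻¹ is analytic into L², and
bounded by ‖Y‖ when the pole is taken at the conjugate of z. Cauchy's formula
(`IsHardyExtension.pairing_cauchyKernel`) links interior values to boundary functions throughout. -/

noncomputable section

/-! ### Multipliers of `L²(ℝ) ⊗ H` -/

/-- The function `t ↦ e^{iht}`, as an element of `L^∞(ℝ)`. -/
def expLp (h : ℝ) : Lp ℂ ⊤ (volume : Measure ℝ) :=
  (memLp_top_of_bound (f := fun t : ℝ => Complex.exp (Complex.I * h * t))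
    (by fun_prop) 1 (Eventually.of_forall fun t => by
      rw [show Complex.I * h * t = ((h * t : ℝ) : ℂ) * Complex.I by push_cast; ring,
        Complex.norm_exp_ofReal_mul_I])).toLp _

theorem coeFn_expLp (h : ℝ) :
    expLp h =ᵐ[volume] fun t : ℝ => Complex.exp (Complex.I * h * t) :=
  MemLp.coeFn_toLp _

/-- The modulation operator `(E_h f)(t) = e^{iht} f(t)` on `L²(ℝ) ⊗ H`. -/
def modulation {H : Type*} [NormedAddCommGroup H] [InnerProductSpace ℂ H] (h : ℝ) :
    L2Space H →L[ℂ] L2Space H :=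
  (ContinuousLinearMap.lsmul ℂ ℂ (E := H)).holderL volume ⊤ 2 2 (expLp h)

theorem coeFn_modulation {H : Type*} [NormedAddCommGroup H] [InnerProductSpace ℂ H] (h : ℝ)
    (f : L2Space H) :
    modulation h f =ᵐ[volume] fun t : ℝ => Complex.exp (Complex.I * h * t) • f t := by
  filter_upwards [(ContinuousLinearMap.lsmul ℂ ℂ (E := H)).coeFn_holder (r := 2) (expLp h) f,
    coeFn_expLp h] with t h1 h2
  rw [← h2]
  exact h1

/-- The Fourier transform intertwines translations and modulations. -/
theorem fourierU_translation {H : Type*} [NormedAddCommGroup H] [InnerProductSpace ℂ H]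
    [CompleteSpace H] (h : ℝ) (f : L2Space H) :
    fourierU H (translation h f) = modulation (-h) (fourierU H f) := by
  have hd : DenseRange (SchwartzMap.toLpCLM ℝ H 2 (volume : Measure ℝ)) :=
    SchwartzMap.denseRange_toLpCLM ENNReal.ofNat_ne_top
  -- The integral formula is available on Schwartz functions; density and continuity give the rest.
  refine hd.induction_on f (isClosed_eq ?_ ?_) fun g => ?_
  · exact (fourierU H).continuous.comp (translation h).continuous
  · exact (modulation (-h)).continuous.comp (fourierU H).continuous
  · have h1 : translation h (g.toLp 2 : L2Space H) =
        (g.compSubConstCLM ℂ (-h)).toLp 2 volume := by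
      apply Lp.ext
      refine (Lp.coeFn_compMeasurePreserving _ _).trans ?_
      filter_upwards [(measurePreserving_add_right volume h).quasiMeasurePreserving.ae
        (g.coeFn_toLp 2 volume), (g.compSubConstCLM ℂ (-h)).coeFn_toLp 2 volume] with t h2 h3
      rw [h3, Function.comp_apply, h2, SchwartzMap.compSubConstCLM_apply, sub_neg_eq_add]
    rw [SchwartzMap.toLpCLM_apply, h1]
    apply Lp.ext
    filter_upwards [fourierU_toLp (g.compSubConstCLM ℂ (-h)), fourierU_toLp g,
      coeFn_modulation (-h) (fourierU H (g.toLp 2))] with t h2 h3 h4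
    rw [h2, h4, h3, smul_comm]
    congr 1
    rw [← integral_smul,
      ← integral_add_right_eq_self (fun x : ℝ => Complex.exp (Complex.I * ((-h : ℝ) : ℂ) * t) •
        Complex.exp (Complex.I * x * t) • g x) h]
    refine integral_congr_ae (Eventually.of_forall fun x => ?_)
    simp only [SchwartzMap.compSubConstCLM_apply, sub_neg_eq_add, smul_smul, ← Complex.exp_add]
    congr 2
    push_cast
    ring

/-- An integrable function all of whose Fourier coefficients vanish is zero. -/
theorem ae_eq_zero_of_integral_exp_eq_zero {w : ℝ → ℂ} (hw : Integrable w)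
    (h : ∀ s : ℝ, ∫ t : ℝ, Complex.exp (Complex.I * s * t) * w t = 0) : ∀ᵐ t, w t = 0 := by
  have h0 : ∀ ξ, FourierTransform.fourier w ξ = 0 := by
    intro ξ
    rw [Real.fourier_eq', ← h (-2 * Real.pi * ξ)]
    refine integral_congr_ae (Eventually.of_forall fun x => ?_)
    simp only [RCLike.inner_apply, conj_trivial, smul_eq_mul]
    congr 2
    push_cast
    ring
  -- A test function g is the Fourier transform of a Schwartz function, so ∫ g w becomes an integral
  -- against the transform of w, which vanishes.
  refine ae_eq_zero_of_integral_contDiff_smul_eq_zero hw.locallyIntegrable fun g g_smooth g_cpt => ?_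
  have hg₁ : HasCompactSupport (Complex.ofRealCLM ∘ g) := g_cpt.comp_left rfl
  have hg₂ : ContDiff ℝ (⊤ : ℕ∞) (Complex.ofRealCLM ∘ g) := by fun_prop
  set φ := hg₁.toSchwartzMap hg₂ with hφ
  have h1 := VectorFourier.integral_fourierIntegral_smul_eq_flip (L := innerₗ ℝ)
    (μ := volume) (ν := volume) (f := (FourierTransformInv.fourierInv φ : SchwartzMap ℝ ℂ)) (g := w)
    Real.continuous_fourierChar continuous_inner (SchwartzMap.integrable _) hw
  have h2 : ∀ ξ, VectorFourier.fourierIntegral Real.fourierChar volume (innerₗ ℝ).flip w ξ = 0 := by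
    intro ξ
    rw [flip_innerₗ]
    exact h0 ξ
  have h3 : ∀ ξ, VectorFourier.fourierIntegral Real.fourierChar volume (innerₗ ℝ)
      (FourierTransformInv.fourierInv φ : SchwartzMap ℝ ℂ) ξ = g ξ := by
    intro ξ
    have : FourierTransform.fourier ((FourierTransformInv.fourierInv φ : SchwartzMap ℝ ℂ)) = φ :=
      FourierTransform.fourier_fourierInv_eq φ
    change FourierTransform.fourier ⇑(FourierTransformInv.fourierInv φ : SchwartzMap ℝ ℂ) ξ = g ξ
    rw [← SchwartzMap.fourier_coe, this, hφ]
    rfl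
  simp only [h2, h3, smul_zero, integral_zero] at h1
  simpa using h1

/-- An operator commuting with modulations and its adjoint agree pointwise. -/
theorem inner_adjoint_ae_eq {H : Type*} [NormedAddCommGroup H] [InnerProductSpace ℂ H]
    [CompleteSpace H] {Y : L2Space H →L[ℂ] L2Space H}
    (hY : ∀ (h : ℝ) (f : L2Space H), Y (modulation h f) = modulation h (Y f)) (f g : L2Space H) :
    ∀ᵐ t : ℝ, inner ℂ (ContinuousLinearMap.adjoint Y g t) (f t) = inner ℂ (g t) (Y f t) := by
  have h1 := L2.integrable_inner (𝕜 := ℂ) (ContinuousLinearMap.adjoint Y g) f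
  have h2 := L2.integrable_inner (𝕜 := ℂ) g (Y f)
  -- The factor e^{ist} can be absorbed into f and moved through Y, so both integrable functions
  -- have the same Fourier transform.
  have key := ae_eq_zero_of_integral_exp_eq_zero (h1.sub h2) fun s => ?_
  · filter_upwards [key] with t ht
    exact sub_eq_zero.1 ht
  have h3 : ∀ u v : L2Space H, inner ℂ u (modulation s v) =
      ∫ t : ℝ, Complex.exp (Complex.I * s * t) * inner ℂ (u t) (v t) := by
    intro u v
    rw [L2.inner_def]
    refine integral_congr_ae ?_
    filter_upwards [coeFn_modulation s v] with t ht
    rw [ht, inner_smul_right]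
  have h4 : ∀ u v : L2Space H, Integrable
      (fun t : ℝ => Complex.exp (Complex.I * s * t) * inner ℂ (u t) (v t)) := by
    intro u v
    refine (L2.integrable_inner (𝕜 := ℂ) u (modulation s v)).congr ?_
    filter_upwards [coeFn_modulation s v] with t ht
    rw [ht, inner_smul_right]
  have h5 : inner ℂ (ContinuousLinearMap.adjoint Y g) (modulation s f) =
      inner ℂ g (modulation s (Y f)) := by
    rw [ContinuousLinearMap.adjoint_inner_left, hY]
  rw [h3, h3] at h5
  simp only [Pi.sub_apply, mul_sub]
  rw [integral_sub (h4 _ _) (h4 _ _), h5, sub_self]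

/-- An operator commuting with modulations commutes with every bounded multiplier. -/
theorem ae_eq_smul_of_commute_modulation {H : Type*} [NormedAddCommGroup H] [InnerProductSpace ℂ H]
    [CompleteSpace H] {Y : L2Space H →L[ℂ] L2Space H}
    (hY : ∀ (h : ℝ) (f : L2Space H), Y (modulation h f) = modulation h (Y f)) {ψ : ℝ → ℂ}
    (hψ : AEStronglyMeasurable ψ) {C : ℝ} (hC : ∀ t, ‖ψ t‖ ≤ C) {f g : L2Space H}
    (hfg : ∀ᵐ t, g t = ψ t • f t) : ∀ᵐ t, Y g t = ψ t • Y f t := by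
  have hm : MemLp (fun t => ψ t • Y f t) 2 volume :=
    (Lp.memLp (Y f)).smul (r := 2) (memLp_top_of_bound hψ C (Eventually.of_forall hC))
  -- Testing against the defect u itself gives ⟨u(t), u(t)⟩ = 0 almost everywhere. A single test
  -- function suffices, so no countable dense set in H is needed.
  set u : L2Space H := Y g - hm.toLp _ with hu
  filter_upwards [inner_adjoint_ae_eq hY f u, inner_adjoint_ae_eq hY g u, hfg,
    Lp.coeFn_sub (Y g) (hm.toLp _), hm.coeFn_toLp] with t h1 h2 h3 h4 h5
  rw [h3, inner_smul_right, h1, ← inner_smul_right] at h2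
  rw [← hu, Pi.sub_apply, h5] at h4
  have h6 : inner ℂ (u t) (u t) = 0 := by
    refine (congrArg (inner ℂ (u t)) h4).trans ?_
    rw [inner_sub_right, h2, sub_self]
  rw [inner_self_eq_zero, h4] at h6
  exact sub_eq_zero.1 h6

/-! ### The boundary function -/

/-- A bounded sequence of operators has an operator extending its strong pointwise limits. -/
theorem exists_operator_of_tendsto {H : Type*} [NormedAddCommGroup H] [InnerProductSpace ℂ H]
    [CompleteSpace H] (A : ℕ → H →L[ℂ] H) {C : ℝ} (hC : 0 ≤ C) (hA : ∀ n, ‖A n‖ ≤ C) :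
    ∃ S : H →L[ℂ] H, ‖S‖ ≤ C ∧
      ∀ a l, Tendsto (fun n => A n a) atTop (𝓝 l) → S a = l := by
  let D : Submodule ℂ H :=
    { carrier := {a | ∃ l, Tendsto (fun n => A n a) atTop (𝓝 l)}
      add_mem' := by
        rintro a b ⟨l, hl⟩ ⟨m, hm⟩
        exact ⟨l + m, by simpa using hl.add hm⟩
      zero_mem' := ⟨0, by simp⟩
      smul_mem' := by
        rintro c a ⟨l, hl⟩
        exact ⟨c • l, by simpa using hl.const_smul c⟩ }
  -- The uniform bound makes the set of convergence closed (an ε/3 argument; C + 1 allows C = 0), so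
  -- it admits an orthogonal projection.
  have hD : IsClosed (D : Set H) := by
    refine isClosed_of_closure_subset fun a ha => ?_
    refine cauchySeq_tendsto_of_complete (Metric.cauchySeq_iff'.2 fun ε hε => ?_)
    have hε' : 0 < ε / (3 * (C + 1)) := by positivity
    obtain ⟨d, ⟨l, hl⟩, hd⟩ := Metric.mem_closure_iff.1 ha _ hε'
    obtain ⟨N, hN⟩ := Metric.cauchySeq_iff'.1 hl.cauchySeq (ε / 3) (by positivity)
    have hb : ∀ n, dist (A n a) (A n d) < ε / 3 := by
      intro n
      rw [dist_eq_norm, ← map_sub]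
      have h1 : ‖a - d‖ < ε / (3 * (C + 1)) := by rwa [dist_eq_norm] at hd
      rw [lt_div_iff₀ (by positivity)] at h1
      have h2 := (A n).le_of_opNorm_le (hA n) (a - d)
      nlinarith [norm_nonneg (a - d)]
    refine ⟨N, fun n hn => ?_⟩
    have h1 := dist_triangle4 (A n a) (A n d) (A N d) (A N a)
    have h2 := hb N
    rw [dist_comm] at h2
    linarith [hb n, hN n hn]
  have : CompleteSpace D := hD.completeSpace_coe
  choose g hg using fun a : D => a.2
  let L : D →ₗ[ℂ] H := linearMapOfTendsto g (fun n => (A n : H →ₗ[ℂ] H) ∘ₗ D.subtype)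
    (tendsto_pi_nhds.2 hg)
  have hL : ∀ a : D, ‖L a‖ ≤ C * ‖a‖ := fun a =>
    le_of_tendsto (hg a).norm (Eventually.of_forall fun n => (A n).le_of_opNorm_le (hA n) _)
  -- Extension by zero on the orthogonal complement preserves the bound C.
  refine ⟨L.mkContinuous C hL ∘L D.orthogonalProjectionOnto, ?_, fun a l hl => ?_⟩
  · calc _ ≤ _ := ContinuousLinearMap.opNorm_comp_le _ _
      _ ≤ C * 1 := mul_le_mul (LinearMap.mkContinuous_norm_le _ hC _)
        (Submodule.orthogonalProjectionOnto_norm_le _) (norm_nonneg _) hC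
      _ = C := mul_one C
  · have h1 : D.orthogonalProjectionOnto a = ⟨a, l, hl⟩ :=
      Submodule.orthogonalProjectionOnto_mem_subspace_eq_self (K := D) ⟨a, l, hl⟩
    rw [ContinuousLinearMap.comp_apply, h1]
    exact tendsto_nhds_unique (hg ⟨a, l, hl⟩) hl

/-- The map `a ↦ 1_s ⊗ a` from `H` to `L²(ℝ) ⊗ H`. -/
def indicatorL (H : Type*) [NormedAddCommGroup H] [InnerProductSpace ℂ H] {s : Set ℝ}
    (hs : MeasurableSet s) (hμ : volume s ≠ ⊤) : H →L[ℂ] L2Space H :=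
  LinearMap.mkContinuous
    { toFun := fun a => indicatorConstLp 2 hs hμ a
      map_add' := fun a b => (indicatorConstLp_add).symm
      map_smul' := fun c a => by
        rw [RingHom.id_apply, indicatorConstLp, indicatorConstLp, ← MemLp.toLp_const_smul]
        congr 1
        exact Set.indicator_const_smul s c fun _ => a }
    (√(volume.real s)) fun a => by
      change ‖indicatorConstLp 2 hs hμ a‖ ≤ _
      rw [norm_indicatorConstLp (by norm_num) (by norm_num), Real.sqrt_eq_rpow, mul_comm]
      simp

theorem norm_indicatorL_le (H : Type*) [NormedAddCommGroup H] [InnerProductSpace ℂ H] {s : Set ℝ}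
    (hs : MeasurableSet s) (hμ : volume s ≠ ⊤) : ‖indicatorL H hs hμ‖ ≤ √(volume.real s) :=
  LinearMap.mkContinuous_norm_le _ (Real.sqrt_nonneg _) _

theorem adjoint_indicatorL_apply {H : Type*} [NormedAddCommGroup H] [InnerProductSpace ℂ H]
    [CompleteSpace H] {s : Set ℝ} (hs : MeasurableSet s) (hμ : volume s ≠ ⊤) (g : L2Space H) :
    ContinuousLinearMap.adjoint (indicatorL H hs hμ) g = ∫ x in s, g x := by
  refine ext_inner_left ℂ fun a => ?_
  rw [ContinuousLinearMap.adjoint_inner_right]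
  exact L2.inner_indicatorConstLp_eq_inner_setIntegral ℂ hs hμ a g

/-- The compression of an operator on `L²(ℝ) ⊗ H` to the functions constant on a ball. -/
def ballAverage {H : Type*} [NormedAddCommGroup H] [InnerProductSpace ℂ H] [CompleteSpace H]
    (Y : L2Space H →L[ℂ] L2Space H) (t r : ℝ) : H →L[ℂ] H :=
  ((volume.real (Metric.closedBall t r))⁻¹ : ℂ) •
    (ContinuousLinearMap.adjoint
        (indicatorL H (measurableSet_closedBall (x := t) (ε := r)) measure_closedBall_lt_top.ne) ∘L
      Y ∘L indicatorL H (measurableSet_closedBall (x := t) (ε := r)) measure_closedBall_lt_top.ne)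

/-- The embedding and its adjoint each cost at most the square root of the volume, which the
normalisation cancels. A ball of volume zero is harmless because 0⁻¹ = 0. -/
theorem norm_ballAverage_le {H : Type*} [NormedAddCommGroup H] [InnerProductSpace ℂ H]
    [CompleteSpace H] (Y : L2Space H →L[ℂ] L2Space H) (t r : ℝ) : ‖ballAverage Y t r‖ ≤ ‖Y‖ := by
  set J := indicatorL H (measurableSet_closedBall (x := t) (ε := r)) measure_closedBall_lt_top.ne
    with hJ
  set v := volume.real (Metric.closedBall t r) with hv
  have hv0 : 0 ≤ v := measureReal_nonneg
  have h1 : ‖J‖ ≤ √v := norm_indicatorL_le _ _ _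
  have h2 : ‖ContinuousLinearMap.adjoint J ∘L Y ∘L J‖ ≤ v * ‖Y‖ := by
    calc _ ≤ ‖ContinuousLinearMap.adjoint J‖ * (‖Y‖ * ‖J‖) :=
          (ContinuousLinearMap.opNorm_comp_le _ _).trans
            (mul_le_mul_of_nonneg_left (ContinuousLinearMap.opNorm_comp_le _ _) (norm_nonneg _))
      _ ≤ √v * (‖Y‖ * √v) := by
          rw [LinearIsometryEquiv.norm_map]
          gcongr
      _ = v * ‖Y‖ := by rw [mul_comm ‖Y‖, ← mul_assoc, Real.mul_self_sqrt hv0]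
  rw [ballAverage, norm_smul, ← Complex.ofReal_inv, Complex.norm_real, Real.norm_eq_abs,
    abs_of_nonneg (inv_nonneg.2 hv0)]
  calc _ ≤ v⁻¹ * (v * ‖Y‖) := mul_le_mul_of_nonneg_left h2 (inv_nonneg.2 hv0)
    _ ≤ ‖Y‖ := by
      rw [← mul_assoc]
      exact mul_le_of_le_one_left (norm_nonneg _) inv_mul_le_one

/-- Restricting an indicator before applying an operator that commutes with modulations. -/
theorem commute_modulation_indicator {H : Type*} [NormedAddCommGroup H] [InnerProductSpace ℂ H]
    [CompleteSpace H] {Y : L2Space H →L[ℂ] L2Space H}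
    (hY : ∀ (h : ℝ) (f : L2Space H), Y (modulation h f) = modulation h (Y f)) {s t : Set ℝ}
    (hs : MeasurableSet s) (hμs : volume s ≠ ⊤) (ht : MeasurableSet t) (hμt : volume t ≠ ⊤)
    (a : H) :
    ∀ᵐ x : ℝ, x ∈ t → s.indicator (Y (indicatorL H ht hμt a)) x = Y (indicatorL H hs hμs a) x := by
  have hst : MeasurableSet (s ∩ t) := hs.inter ht
  have hμst : volume (s ∩ t) ≠ ⊤ := ne_top_of_le_ne_top hμs (measure_mono Set.inter_subset_left)
  have hone : ∀ (u : Set ℝ) (x : ℝ), ‖u.indicator (fun _ => (1 : ℂ)) x‖ ≤ 1 := fun u x => by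
    by_cases hx : x ∈ u <;> simp [hx]
  -- Both sides are compared with the image of the indicator of s ∩ t, factored once through s and
  -- once through t.
  have h1 := ae_eq_smul_of_commute_modulation hY (ψ := s.indicator fun _ => 1)
    (measurable_const.indicator hs).aestronglyMeasurable (hone s)
    (f := indicatorL H ht hμt a) (g := indicatorL H hst hμst a) (by
      filter_upwards [indicatorConstLp_coeFn (p := 2) (hs := ht) (hμs := hμt) (c := a),
        indicatorConstLp_coeFn (p := 2) (hs := hst) (hμs := hμst) (c := a)] with x h1 h2
      refine h2.trans (Eq.trans ?_ (congrArg _ h1.symm))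
      by_cases hxs : x ∈ s <;> by_cases hxt : x ∈ t <;> simp [hxs, hxt])
  have h2 := ae_eq_smul_of_commute_modulation hY (ψ := t.indicator fun _ => 1)
    (measurable_const.indicator ht).aestronglyMeasurable (hone t)
    (f := indicatorL H hs hμs a) (g := indicatorL H hst hμst a) (by
      filter_upwards [indicatorConstLp_coeFn (p := 2) (hs := hs) (hμs := hμs) (c := a),
        indicatorConstLp_coeFn (p := 2) (hs := hst) (hμs := hμst) (c := a)] with x h1 h2
      refine h2.trans (Eq.trans ?_ (congrArg _ h1.symm))
      by_cases hxs : x ∈ s <;> by_cases hxt : x ∈ t <;> simp [hxs, hxt])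
  filter_upwards [h1, h2] with x hx1 hx2 hxt
  rw [hx1, Set.indicator_of_mem hxt, one_smul] at hx2
  rw [← hx2]
  by_cases hxs : x ∈ s <;> simp [hxs]

/-- The averages of an operator that commutes with modulations converge on each vector. -/
theorem ae_tendsto_ballAverage {H : Type*} [NormedAddCommGroup H] [InnerProductSpace ℂ H]
    [CompleteSpace H] {Y : L2Space H →L[ℂ] L2Space H}
    (hY : ∀ (h : ℝ) (f : L2Space H), Y (modulation h f) = modulation h (Y f))
    {δ : ℕ → ℝ} (hδ : Tendsto δ atTop (𝓝[>] 0)) (R : ℝ) (a : H) :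
    ∀ᵐ t : ℝ, t ∈ Metric.ball (0 : ℝ) R → Tendsto (fun n => ballAverage Y t (δ n) a) atTop
      (𝓝 (Y (indicatorL H (measurableSet_ball (x := (0 : ℝ)) (ε := R))
        measure_ball_lt_top.ne a) t)) := by
  set B := Metric.ball (0 : ℝ) R with hB
  set f := Y (indicatorL H (measurableSet_ball (x := (0 : ℝ)) (ε := R)) measure_ball_lt_top.ne a)
    with hf
  -- Lebesgue differentiation; the parameter 0 says that the balls are centred at t. Once such a
  -- ball lies in B, locality replaces its own indicator by that of B.
  filter_upwards [IsUnifLocDoublingMeasure.ae_tendsto_average volume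
    ((Lp.memLp f).locallyIntegrable (by norm_num)) 0] with t ht htB
  have h0 : ∀ᶠ n in atTop, 0 < δ n := hδ self_mem_nhdsWithin
  have h1 := ht (fun _ => t) δ hδ (by
    filter_upwards [h0] with n hn
    simp)
  refine h1.congr' ?_
  have hball : ∀ᶠ r in 𝓝[>] (0 : ℝ), Metric.closedBall t r ⊆ B :=
    nhdsWithin_le_nhds (eventually_closedBall_subset
      (Metric.isOpen_ball.mem_nhds htB))
  filter_upwards [hδ.eventually hball] with n hn
  rw [ballAverage, smul_apply, ContinuousLinearMap.comp_apply,
    adjoint_indicatorL_apply, setAverage_eq, ← Complex.ofReal_inv, ← Complex.coe_smul]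
  congr 1
  refine setIntegral_congr_ae measurableSet_closedBall ?_
  filter_upwards [commute_modulation_indicator hY
    (measurableSet_closedBall (x := t) (ε := δ n)) measure_closedBall_lt_top.ne
    (measurableSet_ball (x := (0 : ℝ)) (ε := R)) measure_ball_lt_top.ne a] with x hx hxt
  rw [ContinuousLinearMap.comp_apply, ← hx (hn hxt), Set.indicator_of_mem hxt]

/-- An operator on `L²(ℝ) ⊗ H` that commutes with modulations is multiplication by a bounded
operator-valued function. -/
theorem exists_multiplier_of_commute_modulation {H : Type*} [NormedAddCommGroup H]
    [InnerProductSpace ℂ H] [CompleteSpace H] {Y : L2Space H →L[ℂ] L2Space H}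
    (hY : ∀ (h : ℝ) (f : L2Space H), Y (modulation h f) = modulation h (Y f)) :
    ∃ S : ℝ → H →L[ℂ] H, (∀ t, ‖S t‖ ≤ ‖Y‖) ∧ ∀ f : L2Space H, ∀ᵐ t, Y f t = S t (f t) := by
  have hδ : Tendsto (fun n : ℕ => 1 / ((n : ℝ) + 1)) atTop (𝓝[>] 0) :=
    tendsto_nhdsWithin_iff.2 ⟨tendsto_one_div_add_atTop_nhds_zero_nat,
      Eventually.of_forall fun n => Set.mem_Ioi.2 (by positivity)⟩
  choose S hS1 hS2 using fun t : ℝ =>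
    exists_operator_of_tendsto (fun n : ℕ => ballAverage Y t (1 / ((n : ℝ) + 1)))
      (norm_nonneg Y) fun n => norm_ballAverage_le Y t _
  refine ⟨S, hS1, fun f => ?_⟩
  induction f using Lp.induction (by norm_num : (2 : ENNReal) ≠ ⊤) with
  | @indicatorConst c s hs hμs =>
    -- The reference function must be square integrable, so the line is exhausted by countably many
    -- balls.
    have h1 : ∀ n : ℕ, ∀ᵐ t : ℝ, t ∈ Metric.ball (0 : ℝ) n →
        Y (indicatorL H hs hμs.ne c) t = S t (indicatorL H hs hμs.ne c t) := by
      intro n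
      filter_upwards [ae_tendsto_ballAverage hY hδ n c, commute_modulation_indicator hY hs hμs.ne
        (measurableSet_ball (x := (0 : ℝ)) (ε := n)) measure_ball_lt_top.ne c,
        indicatorConstLp_coeFn (p := 2) (hs := hs) (hμs := hμs.ne) (c := c)] with t h1 h2 h3 ht
      rw [← h2 ht, show indicatorL H hs hμs.ne c t = _ from h3]
      by_cases hts : t ∈ s
      · rw [Set.indicator_of_mem hts, Set.indicator_of_mem hts]
        exact (hS2 t c _ (h1 ht)).symm
      · rw [Set.indicator_of_notMem hts, Set.indicator_of_notMem hts, map_zero]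
    filter_upwards [ae_all_iff.2 h1] with t ht
    obtain ⟨n, hn⟩ := exists_nat_gt (dist t 0)
    exact ht n hn
  | add hf hg _ h1 h2 =>
    rw [map_add]
    filter_upwards [h1, h2, Lp.coeFn_add (hf.toLp _) (hg.toLp _),
      Lp.coeFn_add (Y (hf.toLp _)) (Y (hg.toLp _))] with t h1 h2 h3 h4
    rw [h3, h4, Pi.add_apply, Pi.add_apply, h1, h2, map_add]
  | isClosed =>
    refine IsSeqClosed.isClosed fun u f hu hf => ?_
    -- Two successive subsequences make both the functions and their images converge almost
    -- everywhere.
    obtain ⟨φ, hφ, h1⟩ := (tendstoInMeasure_of_tendsto_Lp hf).exists_seq_tendsto_ae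
    obtain ⟨ψ, hψ, h2⟩ := (tendstoInMeasure_of_tendsto_Lp
      (((Y.continuous.tendsto f).comp hf).comp hφ.tendsto_atTop)).exists_seq_tendsto_ae
    filter_upwards [h1, h2, ae_all_iff.2 hu] with t h3 h4 h5
    have h6 := ((S t).continuous.tendsto _).comp (h3.comp hψ.tendsto_atTop)
    refine tendsto_nhds_unique h4 (h6.congr fun n => ?_)
    exact (h5 _).symm

/-! ### Cauchy kernels -/

theorem sub_ne_zero_of_im_ne_zero {z : ℂ} (hz : z.im ≠ 0) (t : ℝ) : (t : ℂ) - z ≠ 0 := by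
  intro h
  apply hz
  have := congrArg Complex.im h
  simpa using this

theorem abs_im_le_norm_sub (z : ℂ) (t : ℝ) : |z.im| ≤ ‖(t : ℂ) - z‖ := by
  have := Complex.abs_im_le_norm ((t : ℂ) - z)
  simpa using this

theorem norm_inv_sub_le {z : ℂ} (hz : z.im ≠ 0) (t : ℝ) : ‖((t : ℂ) - z)⁻¹‖ ≤ |z.im|⁻¹ := by
  rw [norm_inv]
  exact inv_anti₀ (abs_pos.2 hz) (abs_im_le_norm_sub z t)

/-- An affine substitution reduces the kernel to (1 + s²)⁻¹, whose integral is π. -/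
theorem norm_inv_sub_sq_eq {z : ℂ} (hz : z.im ≠ 0) (t : ℝ) :
    ‖((t : ℂ) - z)⁻¹‖ ^ 2 = (z.im ^ 2)⁻¹ * (1 + ((t - z.re) / z.im) ^ 2)⁻¹ := by
  rw [norm_inv, inv_pow, Complex.sq_norm, Complex.normSq_apply, ← mul_inv]
  congr 1
  simp only [Complex.sub_re, Complex.ofReal_re, Complex.sub_im, Complex.ofReal_im]
  field_simp
  ring

theorem continuous_inv_sub {z : ℂ} (hz : z.im ≠ 0) : Continuous fun t : ℝ => ((t : ℂ) - z)⁻¹ :=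
  (by fun_prop : Continuous fun t : ℝ => (t : ℂ) - z).inv₀ (sub_ne_zero_of_im_ne_zero hz)

theorem integral_norm_inv_sub_sq {z : ℂ} (hz : z.im ≠ 0) :
    ∫ t : ℝ, ‖((t : ℂ) - z)⁻¹‖ ^ 2 = Real.pi / |z.im| := by
  simp_rw [norm_inv_sub_sq_eq hz]
  rw [integral_const_mul, integral_sub_right_eq_self (fun t : ℝ => (1 + (t / z.im) ^ 2)⁻¹),
    Measure.integral_comp_div (fun t : ℝ => (1 + t ^ 2)⁻¹), integral_univ_inv_one_add_sq,
    smul_eq_mul, ← sq_abs]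
  have := abs_pos.2 hz
  field_simp

theorem memLp_inv_sub {z : ℂ} (hz : z.im ≠ 0) :
    MemLp (fun t : ℝ => ((t : ℂ) - z)⁻¹) 2 volume := by
  refine (memLp_two_iff_integrable_sq_norm (continuous_inv_sub hz).aestronglyMeasurable).2 ?_
  simp_rw [norm_inv_sub_sq_eq hz]
  exact ((integrable_inv_one_add_sq.comp_div hz).comp_sub_right z.re).const_mul _

open Classical in
/-- The function `t ↦ (t - z)⁻¹` in `L²(ℝ)`, for nonreal `z`. -/
def cauchyKernel (z : ℂ) : Lp ℂ 2 (volume : Measure ℝ) :=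
  if hz : z.im ≠ 0 then (memLp_inv_sub hz).toLp _ else 0

theorem coeFn_cauchyKernel {z : ℂ} (hz : z.im ≠ 0) :
    cauchyKernel z =ᵐ[volume] fun t : ℝ => ((t : ℂ) - z)⁻¹ := by
  rw [cauchyKernel, dif_pos hz]
  exact MemLp.coeFn_toLp _

theorem norm_sq_cauchyKernel {z : ℂ} (hz : z.im ≠ 0) :
    ‖cauchyKernel z‖ ^ 2 = Real.pi / |z.im| := by
  have h1 : ((‖cauchyKernel z‖ : ℂ)) ^ 2 = ((Real.pi / |z.im| : ℝ) : ℂ) := by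
    rw [← integral_norm_inv_sub_sq hz, ← integral_complex_ofReal]
    refine (inner_self_eq_norm_sq_to_K (𝕜 := ℂ) (cauchyKernel z)).symm.trans ?_
    rw [L2.inner_def]
    refine integral_congr_ae ?_
    filter_upwards [coeFn_cauchyKernel hz] with t ht
    rw [inner_self_eq_norm_sq_to_K, ht]
    push_cast
    rfl
  exact_mod_cast h1

/-- The resolvent identity, with one factor bounded by its supremum on the line. -/
theorem norm_cauchyKernel_sub_le {z w : ℂ} (hz : z.im ≠ 0) (hw : w.im ≠ 0) :
    ‖cauchyKernel w - cauchyKernel z‖ ≤ ‖w - z‖ * |w.im|⁻¹ * ‖cauchyKernel z‖ := by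
  refine Lp.norm_le_mul_norm_of_ae_le_mul ?_
  filter_upwards [Lp.coeFn_sub (cauchyKernel w) (cauchyKernel z), coeFn_cauchyKernel hz,
    coeFn_cauchyKernel hw] with t h1 h2 h3
  have h4 : ((t : ℂ) - w)⁻¹ - ((t : ℂ) - z)⁻¹ = (w - z) * ((t : ℂ) - w)⁻¹ * ((t : ℂ) - z)⁻¹ := by
    have := sub_ne_zero_of_im_ne_zero hz t
    have := sub_ne_zero_of_im_ne_zero hw t
    field_simp
    ring
  rw [h1, Pi.sub_apply, h2, h3, h4, norm_mul, norm_mul]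
  gcongr
  exact norm_inv_sub_le hw t

theorem continuousAt_cauchyKernel {z : ℂ} (hz : z.im ≠ 0) : ContinuousAt cauchyKernel z := by
  refine tendsto_iff_norm_sub_tendsto_zero.2 ?_
  have h1 : Tendsto (fun w : ℂ => ‖w - z‖ * |w.im|⁻¹ * ‖cauchyKernel z‖) (𝓝 z) (𝓝 0) := by
    have h2 : ContinuousAt (fun w : ℂ => ‖w - z‖ * |w.im|⁻¹ * ‖cauchyKernel z‖) z := by
      have : ContinuousAt (fun w : ℂ => |w.im|⁻¹) z :=
        ContinuousAt.inv₀ (by fun_prop) (abs_ne_zero.2 hz)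
      fun_prop
    simpa using h2.tendsto
  refine tendsto_of_tendsto_of_tendsto_of_le_of_le' tendsto_const_nhds h1
    (Eventually.of_forall fun _ => norm_nonneg _) ?_
  filter_upwards [Complex.continuous_im.continuousAt.eventually_ne hz] with w hw
  exact norm_cauchyKernel_sub_le hz hw

/-- By the resolvent identity the slope is exactly the kernel at w multiplied by (t - z)⁻¹, so
continuity of the kernel already yields the derivative. -/
theorem differentiableAt_cauchyKernel {z : ℂ} (hz : z.im ≠ 0) :
    DifferentiableAt ℂ cauchyKernel z := by
  let r : Lp ℂ ⊤ (volume : Measure ℝ) :=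
    (memLp_top_of_bound (continuous_inv_sub hz).aestronglyMeasurable _
      (Eventually.of_forall (norm_inv_sub_le hz))).toLp _
  let R : Lp ℂ 2 (volume : Measure ℝ) →L[ℂ] Lp ℂ 2 (volume : Measure ℝ) :=
    (ContinuousLinearMap.lsmul ℂ ℂ (E := ℂ)).holderL volume ⊤ 2 2 r
  have hR : ∀ g, R g =ᵐ[volume] fun t => ((t : ℂ) - z)⁻¹ * g t := by
    intro g
    filter_upwards [(ContinuousLinearMap.lsmul ℂ ℂ (E := ℂ)).coeFn_holder (r := 2) r g,
      MemLp.coeFn_toLp (memLp_top_of_bound (continuous_inv_sub hz).aestronglyMeasurable _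
      (Eventually.of_forall (norm_inv_sub_le hz)))] with t h1 h2
    rw [← h2]
    exact h1
  refine HasDerivAt.differentiableAt (f' := R (cauchyKernel z))
    (hasDerivAt_iff_tendsto_slope.2 ?_)
  refine ((R.continuous.tendsto _).comp
    ((continuousAt_cauchyKernel hz).mono_left nhdsWithin_le_nhds)).congr' ?_
  filter_upwards [self_mem_nhdsWithin, nhdsWithin_le_nhds
    (Complex.continuous_im.continuousAt.eventually_ne hz)] with w hwz hw
  have hwz' : w - z ≠ 0 := sub_ne_zero.2 hwz
  rw [Function.comp_apply, slope_def_module]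
  apply Lp.ext
  filter_upwards [hR (cauchyKernel w), Lp.coeFn_smul (w - z)⁻¹ (cauchyKernel w - cauchyKernel z),
    Lp.coeFn_sub (cauchyKernel w) (cauchyKernel z), coeFn_cauchyKernel hz,
    coeFn_cauchyKernel hw] with t h1 h2 h3 h4 h5
  rw [h1, h2, Pi.smul_apply, h3, Pi.sub_apply, h4, h5, smul_eq_mul]
  have := sub_ne_zero_of_im_ne_zero hz t
  have := sub_ne_zero_of_im_ne_zero hw t
  field_simp
  ring

/-- The pairing `(κ, g) ↦ ∫ κ g` of `L²(ℝ)` and `L²(ℝ) ⊗ H`. -/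
def pairing (H : Type*) [NormedAddCommGroup H] [InnerProductSpace ℂ H] [CompleteSpace H] :
    Lp ℂ 2 (volume : Measure ℝ) →L[ℂ] L2Space H →L[ℂ] H :=
  (ContinuousLinearMap.lsmul ℂ ℂ (E := H)).lpPairing volume 2 2

theorem pairing_apply {H : Type*} [NormedAddCommGroup H] [InnerProductSpace ℂ H] [CompleteSpace H]
    (κ : Lp ℂ 2 (volume : Measure ℝ)) (g : L2Space H) : pairing H κ g = ∫ t : ℝ, κ t • g t :=
  ContinuousLinearMap.lpPairing_eq_integral _ _ _

theorem integrable_smul_L2 {H : Type*} [NormedAddCommGroup H] [InnerProductSpace ℂ H]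
    (κ : Lp ℂ 2 (volume : Measure ℝ)) (g : L2Space H) : Integrable fun t : ℝ => κ t • g t :=
  memLp_one_iff_integrable.1 <|
    (ContinuousLinearMap.lsmul ℂ ℂ (E := H)).memLp_of_bilin 1 (Lp.memLp κ) (Lp.memLp g)

/-- Cauchy–Schwarz with the norm kept inside the integral, as required for the uniform L¹ bound in
`integral_line_eq`. -/
theorem integral_norm_smul_L2_le {H : Type*} [NormedAddCommGroup H] [InnerProductSpace ℂ H]
    (κ : Lp ℂ 2 (volume : Measure ℝ)) (g : L2Space H) :
    ∫ t : ℝ, ‖κ t • g t‖ ≤ ‖κ‖ * ‖g‖ := by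
  let B := ContinuousLinearMap.lsmul ℂ ℂ (E := H)
  have h1 := B.norm_holder_apply_apply_le (r := 1) κ g
  have h2 : ‖B‖ ≤ 1 := ContinuousLinearMap.opNorm_lsmul_le
  have h3 : ∫ t : ℝ, ‖κ t • g t‖ = ‖B.holder 1 κ g‖ := by
    rw [L1.norm_eq_integral_norm]
    refine integral_congr_ae ?_
    filter_upwards [B.coeFn_holder (r := 1) κ g] with t ht
    rw [ht]
    rfl
  rw [h3]
  refine h1.trans ?_
  rw [mul_assoc]
  exact mul_le_of_le_one_left (by positivity) h2

theorem norm_pairing_le {H : Type*} [NormedAddCommGroup H] [InnerProductSpace ℂ H]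
    [CompleteSpace H] (κ : Lp ℂ 2 (volume : Measure ℝ)) (g : L2Space H) :
    ‖pairing H κ g‖ ≤ ‖κ‖ * ‖g‖ := by
  rw [pairing_apply]
  exact (norm_integral_le_integral_norm _).trans (integral_norm_smul_L2_le κ g)

/-- The map `a ↦ κ ⊗ a` from `H` to `L²(ℝ) ⊗ H`. -/
def tensorL (H : Type*) [NormedAddCommGroup H] [InnerProductSpace ℂ H]
    (κ : Lp ℂ 2 (volume : Measure ℝ)) : H →L[ℂ] L2Space H :=
  LinearMap.mkContinuous
    { toFun := fun a => (ContinuousLinearMap.toSpanSingleton ℂ a).compLp κ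
      map_add' := fun a b => by
        rw [← ContinuousLinearMap.add_compLp, ContinuousLinearMap.toSpanSingleton_add]
      map_smul' := fun c a => by
        rw [RingHom.id_apply, ← ContinuousLinearMap.smul_compLp,
          ContinuousLinearMap.toSpanSingleton_smul] }
    ‖κ‖ fun a => by
      refine (ContinuousLinearMap.norm_compLp_le _ _).trans_eq ?_
      rw [ContinuousLinearMap.norm_toSpanSingleton, mul_comm]

theorem coeFn_tensorL {H : Type*} [NormedAddCommGroup H] [InnerProductSpace ℂ H]
    (κ : Lp ℂ 2 (volume : Measure ℝ)) (a : H) : tensorL H κ a =ᵐ[volume] fun t => κ t • a :=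
  ContinuousLinearMap.coeFn_compLp _ _

theorem norm_tensorL_le {H : Type*} [NormedAddCommGroup H] [InnerProductSpace ℂ H]
    (κ : Lp ℂ 2 (volume : Measure ℝ)) (a : H) : ‖tensorL H κ a‖ ≤ ‖κ‖ * ‖a‖ :=
  (tensorL H κ).le_of_opNorm_le (LinearMap.mkContinuous_norm_le _ (norm_nonneg _) _) a

/-! ### Hardy functions -/

theorem isOpen_upperHalf : IsOpen upperHalf :=
  isOpen_lt continuous_const Complex.continuous_im

theorem line_mem_upperHalf (x : ℝ) {y : ℝ} (hy : 0 < y) : (x + y * Complex.I : ℂ) ∈ upperHalf := by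
  simpa [upperHalf] using hy

/-- The integrals over horizontal lines of a holomorphic function with uniformly bounded
`L¹`-norms on them do not depend on the line. -/
theorem integral_line_eq {H : Type*} [NormedAddCommGroup H] [InnerProductSpace ℂ H]
    [CompleteSpace H] {Φ : ℂ → H} (hΦ : DifferentiableOn ℂ Φ upperHalf)
    (hint : ∀ y : ℝ, 0 < y → Integrable fun x : ℝ => Φ (x + y * Complex.I)) {C : ℝ}
    (hC : ∀ y : ℝ, 0 < y → ∫ x : ℝ, ‖Φ (x + y * Complex.I)‖ ≤ C) {a b : ℝ} (ha : 0 < a)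
    (hab : a ≤ b) :
    ∫ x : ℝ, Φ (x + a * Complex.I) = ∫ x : ℝ, Φ (x + b * Complex.I) := by
  have hmeas : AEStronglyMeasurable (fun p : ℝ × ℝ => Φ (p.1 + p.2 * Complex.I))
      ((volume : Measure ℝ).prod (volume.restrict (Set.Ioc a b))) := by
    rw [← Measure.restrict_univ (μ := (volume : Measure ℝ)), Measure.prod_restrict]
    refine ContinuousOn.aestronglyMeasurable ?_ (MeasurableSet.univ.prod measurableSet_Ioc)
    refine hΦ.continuousOn.comp (by fun_prop) fun p hp => ?_
    exact line_mem_upperHalf p.1 (ha.trans hp.2.1)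
  have hprod : Integrable (fun p : ℝ × ℝ => Φ (p.1 + p.2 * Complex.I))
      ((volume : Measure ℝ).prod (volume.restrict (Set.Ioc a b))) := by
    refine (integrable_prod_iff' hmeas).2 ⟨?_, ?_⟩
    · filter_upwards [ae_restrict_mem measurableSet_Ioc] with y hy
      exact hint y (ha.trans hy.1)
    · refine Integrable.of_bound (C := C) ?_ ?_
      · exact hmeas.norm.prod_swap.integral_prod_right'
      · filter_upwards [ae_restrict_mem measurableSet_Ioc] with y hy
        rw [Real.norm_of_nonneg (integral_nonneg fun _ => norm_nonneg _)]
        exact hC y (ha.trans hy.1)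
  -- The integral over a vertical side, as a function of its abscissa; Fubini on the strip makes it
  -- integrable.
  set v : ℝ → H := fun x => ∫ y in a..b, Φ (x + y * Complex.I) with hv
  have hvint : Integrable v := by
    refine hprod.integral_prod_left.congr (Eventually.of_forall fun x => ?_)
    simp only [hv]
    rw [intervalIntegral.integral_of_le hab]
  have hu : ∀ R : ℝ, v R - v (-R) = Complex.I •
      ((∫ x in -R..R, Φ (x + a * Complex.I)) - ∫ x in -R..R, Φ (x + b * Complex.I)) := by
    intro R
    have h := Complex.integral_boundary_rect_eq_zero_of_differentiableOn Φ
      (-R + a * Complex.I) (R + b * Complex.I) (hΦ.mono fun w hw => by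
        have h2 := hw.2
        simp only [Set.mem_preimage, Complex.add_im, Complex.neg_im, Complex.ofReal_im,
          Complex.mul_im, Complex.ofReal_re, Complex.I_im, Complex.I_re] at h2
        simp only [mul_one, mul_zero, add_zero, neg_zero, zero_add] at h2
        rw [Set.uIcc_of_le hab] at h2
        exact lt_of_lt_of_le ha h2.1)
    simp only [Complex.add_im, Complex.neg_im, Complex.ofReal_im, Complex.add_re, Complex.neg_re,
      Complex.mul_im, Complex.mul_re, Complex.ofReal_re, Complex.I_im, Complex.I_re, mul_one,
      mul_zero, add_zero, neg_zero, zero_add, sub_zero, Complex.ofReal_neg] at h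
    rw [add_sub_assoc, ← smul_sub, add_eq_zero_iff_eq_neg] at h
    rw [h, smul_neg, smul_smul, Complex.I_mul_I, neg_smul, one_smul, neg_neg, hv]
    simp
  have hlim : Tendsto (fun R : ℝ => v R - v (-R)) atTop (𝓝 (Complex.I •
      ((∫ x : ℝ, Φ (x + a * Complex.I)) - ∫ x : ℝ, Φ (x + b * Complex.I)))) := by
    simp_rw [hu]
    exact ((intervalIntegral_tendsto_integral (hint a ha) tendsto_neg_atTop_atBot tendsto_id).sub
      (intervalIntegral_tendsto_integral (hint b (ha.trans_le hab)) tendsto_neg_atTop_atBot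
        tendsto_id)).const_smul _
  -- An integrable function having a limit at infinity has limit zero, so the vertical sides drop
  -- out.
  have hzero := IntegrableAtFilter.eq_zero_of_tendsto (μ := volume)
    ((hvint.sub hvint.comp_neg).integrableAtFilter atTop) (fun s hs => by
      obtain ⟨c, hc⟩ := mem_atTop_sets.1 hs
      rw [← top_le_iff, ← Real.volume_Ici (a := c)]
      exact measure_mono hc) hlim
  rw [smul_eq_zero_iff_right Complex.I_ne_zero] at hzero
  exact sub_eq_zero.1 hzero

section

variable {H : Type*} [NormedAddCommGroup H] [InnerProductSpace ℂ H]

theorem IsHardyExtension.memLp {F : ℂ → H} {f : L2Space H} (hF : IsHardyExtension F f) {y : ℝ}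
    (hy : 0 < y) : MemLp (fun x : ℝ => F (x + y * Complex.I)) 2 volume := by
  obtain ⟨M, hM⟩ := hF.bounded
  exact ⟨aestronglyMeasurable_line hF.1 hy, (hM y hy).trans_lt ENNReal.coe_lt_top⟩

theorem IsHardyExtension.norm_toLp_sub {F : ℂ → H} {f : L2Space H} (hF : IsHardyExtension F f)
    {y : ℝ} (hy : 0 < y) : ‖(hF.memLp hy).toLp _ - f‖ =
      (eLpNorm (fun x : ℝ => F (x + y * Complex.I) - f x) 2 volume).toReal := by
  rw [Lp.norm_def]
  congr 1
  refine eLpNorm_congr_ae ?_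
  filter_upwards [Lp.coeFn_sub ((hF.memLp hy).toLp _) f, (hF.memLp hy).coeFn_toLp] with x h1 h2
  rw [h1, Pi.sub_apply, h2]

/-- Hardy functions are orthogonal to Cauchy kernels with poles in the lower half-plane. -/
theorem IsHardyExtension.pairing_eq_zero [CompleteSpace H] {F : ℂ → H} {f : L2Space H}
    (hF : IsHardyExtension F f) {ζ : ℂ} (hζ : ζ.im < 0) : pairing H (cauchyKernel ζ) f = 0 := by
  obtain ⟨M, hM⟩ := hF.bounded
  have him : ∀ y : ℝ, (ζ - y * Complex.I).im = ζ.im - y := fun y => by simp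
  have hne : ∀ y : ℝ, 0 ≤ y → (ζ - y * Complex.I).im ≠ 0 := fun y hy => by
    rw [him]; linarith
  have hnorm : ∀ y : ℝ, 0 ≤ y → ‖cauchyKernel (ζ - y * Complex.I)‖ = √(Real.pi / (y - ζ.im)) := by
    intro y hy
    rw [← Real.sqrt_sq (norm_nonneg (cauchyKernel _)), norm_sq_cauchyKernel (hne y hy), him,
      abs_of_neg (by linarith), neg_sub]
  have hnorm' : ∀ y : ℝ, 0 ≤ y →
      ‖cauchyKernel (ζ - y * Complex.I)‖ ≤ √(Real.pi / (-ζ.im)) := by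
    intro y hy
    rw [hnorm y hy]
    have : 0 < -ζ.im := by linarith
    gcongr
    linarith
  have hg : ∀ (y : ℝ) (hy : 0 < y), ‖(hF.memLp hy).toLp _‖ ≤ M := by
    intro y hy
    rw [Lp.norm_toLp]
    exact ENNReal.toReal_le_coe_of_le_coe (hM y hy)
  -- At height y this is the kernel with pole ζ - iy times the slice of F, both bounded in L²
  -- uniformly in y.
  set Φ : ℂ → H := fun w => (w - ζ)⁻¹ • F w with hΦ
  have hline : ∀ (y : ℝ) (hy : 0 < y), (fun t : ℝ => cauchyKernel (ζ - y * Complex.I) t •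
      (hF.memLp hy).toLp _ t) =ᵐ[volume] fun x : ℝ => Φ (x + y * Complex.I) := by
    intro y hy
    filter_upwards [coeFn_cauchyKernel (hne y hy.le), (hF.memLp hy).coeFn_toLp] with t h1 h2
    rw [h1, h2, hΦ]
    congr 2
    ring
  have hdiff : DifferentiableOn ℂ Φ upperHalf := by
    refine DifferentiableOn.smul (DifferentiableOn.inv (by fun_prop) fun w hw h => ?_) hF.1
    rw [sub_eq_zero.1 h] at hw
    exact absurd hw (not_lt.2 hζ.le)
  have hconst : ∀ y : ℝ, ∀ hy : 0 < y, ∀ b, y ≤ b →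
      pairing H (cauchyKernel (ζ - y * Complex.I)) ((hF.memLp hy).toLp _) =
        ∫ x : ℝ, Φ (x + b * Complex.I) := by
    intro y hy b hb
    rw [pairing_apply, integral_congr_ae (hline y hy)]
    refine integral_line_eq hdiff (fun y hy => (integrable_smul_L2 _ _).congr (hline y hy))
      (C := √(Real.pi / (-ζ.im)) * M) (fun y hy => ?_) hy hb
    have h1 : ∫ x : ℝ, ‖Φ (x + y * Complex.I)‖ = ∫ t : ℝ, ‖cauchyKernel (ζ - y * Complex.I) t •
        (hF.memLp hy).toLp _ t‖ := by
      refine integral_congr_ae ?_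
      filter_upwards [hline y hy] with t ht
      rw [ht]
    rw [h1]
    refine (integral_norm_smul_L2_le _ _).trans ?_
    exact mul_le_mul (hnorm' y hy.le) (hg y hy) (norm_nonneg _) (Real.sqrt_nonneg _)
  -- The integral does not depend on the height b, while the kernel norm √(π / (b - Im ζ)) tends to
  -- 0 as b grows.
  have hzero : ∀ (y : ℝ) (hy : 0 < y),
      pairing H (cauchyKernel (ζ - y * Complex.I)) ((hF.memLp hy).toLp _) = 0 := by
    intro y hy
    have h1 : Tendsto (fun b : ℝ => √(Real.pi / (b - ζ.im)) * M) atTop (𝓝 0) := by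
      have h2 : Tendsto (fun b : ℝ => Real.pi / (b - ζ.im)) atTop (𝓝 0) :=
        tendsto_const_nhds.div_atTop (tendsto_atTop_add_const_right _ _ tendsto_id)
      simpa using (h2.sqrt).mul_const (M : ℝ)
    refine norm_le_zero_iff.1 (ge_of_tendsto h1 ?_)
    filter_upwards [eventually_ge_atTop y] with b hb
    have hb0 : 0 < b := hy.trans_le hb
    rw [hconst y hy b hb, ← hconst b hb0 b le_rfl, ← hnorm b hb0.le]
    exact (norm_pairing_le _ _).trans (mul_le_mul_of_nonneg_left (hg b hb0) (norm_nonneg _))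
  have hlim : Tendsto (fun y : ℝ => ‖cauchyKernel ζ - cauchyKernel (ζ - y * Complex.I)‖ * ‖f‖ +
      √(Real.pi / (-ζ.im)) *
        (eLpNorm (fun x : ℝ => F (x + y * Complex.I) - f x) 2 volume).toReal)
      (𝓝[>] 0) (𝓝 0) := by
    have h1 := (ENNReal.tendsto_toReal ENNReal.zero_ne_top).comp hF.tendsto
    have h2 : Tendsto (fun y : ℝ => ζ - y * Complex.I) (𝓝[>] 0) (𝓝 ζ) := by
      have : Continuous fun y : ℝ => ζ - y * Complex.I := by fun_prop
      simpa using (this.tendsto 0).mono_left nhdsWithin_le_nhds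
    have h3 := ((continuousAt_cauchyKernel hζ.ne).tendsto.comp h2).const_sub (cauchyKernel ζ)
    simpa using (h3.norm.mul_const ‖f‖).add (h1.const_mul _)
  refine norm_le_zero_iff.1 (ge_of_tendsto hlim ?_)
  filter_upwards [self_mem_nhdsWithin] with y hy
  have hy : 0 < y := hy
  rw [← hF.norm_toLp_sub hy, norm_sub_rev _ f]
  set κ := cauchyKernel (ζ - y * Complex.I) with hκ
  set g := (hF.memLp hy).toLp _ with hg'
  have h1 : pairing H (cauchyKernel ζ) f =
      pairing H (cauchyKernel ζ - κ) f + pairing H κ (f - g) := by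
    have : pairing H κ g = 0 := hzero y hy
    rw [map_sub, map_sub, sub_apply, this]
    abel
  rw [h1]
  refine (norm_add_le _ _).trans (add_le_add (norm_pairing_le _ _) ((norm_pairing_le _ _).trans ?_))
  exact mul_le_mul_of_nonneg_right (hnorm' y hy.le) (norm_nonneg _)

/-- Cauchy kernels with poles in the lower half-plane are Hardy functions. -/
theorem isHardyExtension_cauchyKernel {ζ : ℂ} (hζ : ζ.im < 0) (a : H) :
    IsHardyExtension (fun w => (w - ζ)⁻¹ • a) (tensorL H (cauchyKernel ζ) a) := by
  have hcoe : tensorL H (cauchyKernel ζ) a =ᵐ[volume] fun t : ℝ => ((t : ℂ) - ζ)⁻¹ • a := by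
    filter_upwards [coeFn_tensorL (cauchyKernel ζ) a, coeFn_cauchyKernel hζ.ne] with t h1 h2
    rw [h1, h2]
  have him : ∀ (x y : ℝ), (x + y * Complex.I - ζ : ℂ).im = y - ζ.im := fun x y => by simp
  have hne : ∀ (x : ℝ) {y : ℝ}, 0 ≤ y → (x + y * Complex.I - ζ : ℂ) ≠ 0 := by
    intro x y hy h
    have := him x y
    rw [h, Complex.zero_im] at this
    linarith
  -- Moving up increases the distance to the pole, so the boundary function dominates every slice.
  have hle : ∀ (x : ℝ) {y : ℝ}, 0 < y → ‖(x - ζ : ℂ)‖ ≤ ‖(x + y * Complex.I - ζ : ℂ)‖ := by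
    intro x y hy
    rw [← sq_le_sq₀ (norm_nonneg _) (norm_nonneg _), Complex.sq_norm, Complex.sq_norm,
      Complex.normSq_apply, Complex.normSq_apply, him]
    simp only [Complex.sub_re, Complex.add_re, Complex.sub_im, Complex.ofReal_re, Complex.ofReal_im,
      Complex.mul_re, Complex.I_re, Complex.I_im]
    nlinarith
  refine ⟨?_, ⟨‖tensorL H (cauchyKernel ζ) a‖₊, fun y hy => ?_⟩, ?_⟩
  · refine DifferentiableOn.smul_const (DifferentiableOn.inv (by fun_prop) fun w hw h => ?_) a
    rw [sub_eq_zero.1 h] at hw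
    exact absurd hw (not_lt.2 hζ.le)
  · rw [← enorm_eq_nnnorm, Lp.enorm_def]
    refine eLpNorm_mono_ae ?_
    filter_upwards [hcoe] with x hx
    rw [hx, norm_smul, norm_smul, norm_inv, norm_inv]
    refine mul_le_mul_of_nonneg_right (inv_anti₀ (norm_pos_iff.2 ?_) (hle x hy)) (norm_nonneg _)
    exact sub_ne_zero_of_im_ne_zero hζ.ne x
  · have hlim : Tendsto (fun y : ℝ => ENNReal.ofReal (y * (-ζ.im)⁻¹) *
        eLpNorm (tensorL H (cauchyKernel ζ) a) 2 volume) (𝓝[>] 0) (𝓝 0) := by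
      have h1 : Continuous fun y : ℝ => ENNReal.ofReal (y * (-ζ.im)⁻¹) :=
        ENNReal.continuous_ofReal.comp (by fun_prop)
      have h2 := (h1.tendsto 0).mono_left (nhdsWithin_le_nhds (s := Set.Ioi 0))
      have h3 := ENNReal.Tendsto.mul_const (b := eLpNorm (tensorL H (cauchyKernel ζ) a) 2 volume)
        h2 (Or.inr (Lp.eLpNorm_ne_top _))
      simpa using h3
    refine tendsto_of_tendsto_of_tendsto_of_le_of_le' tendsto_const_nhds hlim
      (Eventually.of_forall fun _ => zero_le) ?_
    filter_upwards [self_mem_nhdsWithin] with y hy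
    have hy : 0 < y := hy
    refine eLpNorm_le_mul_eLpNorm_of_ae_le_mul ?_ _
    filter_upwards [hcoe] with x hx
    have h1 := hne x hy.le
    have h2 := sub_ne_zero_of_im_ne_zero hζ.ne x
    have h3 : (x + y * Complex.I - ζ : ℂ)⁻¹ - ((x : ℂ) - ζ)⁻¹ =
        -(y * Complex.I) * (x + y * Complex.I - ζ : ℂ)⁻¹ * ((x : ℂ) - ζ)⁻¹ := by
      field_simp
      ring
    have h4 : ‖(x + y * Complex.I - ζ : ℂ)⁻¹‖ ≤ (-ζ.im)⁻¹ := by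
      rw [norm_inv]
      refine inv_anti₀ (by linarith) ?_
      have := abs_im_le_norm_sub ζ x
      rw [abs_of_neg hζ] at this
      exact this.trans (hle x hy)
    rw [hx, ← sub_smul, h3, norm_smul, norm_smul, norm_mul, norm_mul, norm_neg, norm_mul,
      Complex.norm_I, mul_one, Complex.norm_real, Real.norm_of_nonneg hy.le, mul_assoc]
    gcongr

/-- A Hardy function vanishing at `z` remains a Hardy function when the zero is moved to
another point. -/
theorem IsHardyExtension.exists_div [CompleteSpace H] {F : ℂ → H} {f : L2Space H} (hF : IsHardyExtension F f)
    {z : ℂ} (hz : 0 < z.im) (hFz : F z = 0) (ζ : ℂ) :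
    ∃ q ∈ hardySpace H, ∀ᵐ t : ℝ, q t = (1 + (z - ζ) * ((t : ℂ) - z)⁻¹) • f t := by
  have hzne := hz.ne'
  -- The closed disc of radius r about z stays in the half-plane, and lines at height below r avoid
  -- its interior.
  set r := z.im / 2 with hr
  have hr0 : 0 < r := by positivity
  set K : ℝ := 1 + ‖z - ζ‖ * r⁻¹ with hK
  have hK0 : 0 ≤ K := by positivity
  -- This is (w - ζ) F(w) / (w - z) with the removable singularity filled in.
  set Q : ℂ → H := fun w => (w - ζ) • dslope F z w with hQ
  have hQdiff : DifferentiableOn ℂ Q upperHalf :=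
    DifferentiableOn.smul (by fun_prop)
      ((Complex.differentiableOn_dslope (isOpen_upperHalf.mem_nhds hz)).2 hF.1)
  have hQF : ∀ w, w ≠ z → Q w = (1 + (z - ζ) * (w - z)⁻¹) • F w := by
    intro w hw
    have hw' : w - z ≠ 0 := sub_ne_zero.2 hw
    have h1 : w - ζ = (1 + (z - ζ) * (w - z)⁻¹) * (w - z) := by
      rw [add_mul, mul_assoc, inv_mul_cancel₀ hw']
      ring
    change (w - ζ) • dslope F z w = _
    rw [← sub_smul_dslope_of_zero hFz w, smul_smul, ← h1]
  have hψ : ∀ w, r ≤ ‖w - z‖ → ‖1 + (z - ζ) * (w - z)⁻¹‖ ≤ K := by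
    intro w hw
    refine (norm_add_le _ _).trans ?_
    rw [norm_one, norm_mul, norm_inv, hK]
    gcongr
  have hψm : Measurable fun t : ℝ => 1 + (z - ζ) * ((t : ℂ) - z)⁻¹ :=
    (continuous_const.add (continuous_const.mul (continuous_inv_sub hzne))).measurable
  have hzt : ∀ t : ℝ, r ≤ ‖(t : ℂ) - z‖ := fun t => by
    have := abs_im_le_norm_sub z t
    rw [abs_of_pos hz] at this
    linarith
  have hq : MemLp (fun t : ℝ => (1 + (z - ζ) * ((t : ℂ) - z)⁻¹) • f t) 2 volume :=
    (Lp.memLp f).smul (r := 2) (memLp_top_of_bound hψm.aestronglyMeasurable K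
      (Eventually.of_forall fun t => hψ t (hzt t)))
  refine ⟨hq.toLp _, ⟨Q, hQdiff, ?_, ?_⟩, hq.coeFn_toLp⟩
  · obtain ⟨M, hM⟩ := hF.bounded
    have hsub : Metric.closedBall z r ⊆ upperHalf := by
      intro w hw
      have h1 : |(w - z).im| ≤ r :=
        (Complex.abs_im_le_norm _).trans (by simpa [dist_eq_norm] using hw)
      rw [Complex.sub_im] at h1
      have := (abs_le.1 h1).1
      change 0 < w.im
      linarith
    obtain ⟨B, hB⟩ := (isCompact_closedBall z r).exists_bound_of_continuousOn
      (hQdiff.continuousOn.mono hsub)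
    -- Near z the factor is unbounded, so Q is bounded by its maximum B on the disc; a line meets
    -- the disc only above this interval.
    set ind : ℝ → ℝ := (Metric.closedBall z.re r).indicator fun _ => B with hind
    have hB0 : 0 ≤ B := (norm_nonneg _).trans (hB z (Metric.mem_closedBall_self hr0.le))
    have hindLp : MemLp ind 2 volume :=
      memLp_indicator_const 2 measurableSet_closedBall B (Or.inr measure_closedBall_lt_top.ne)
    have hbound : ∀ y : ℝ, 0 < y → eLpNorm (fun x : ℝ => Q (x + y * Complex.I)) 2 volume ≤
        ENNReal.ofReal K * M + eLpNorm ind 2 volume := by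
      intro y hy
      have h1 : eLpNorm (fun x : ℝ => K * ‖F (x + y * Complex.I)‖) 2 volume ≤
          ENNReal.ofReal K * M := by
        refine le_trans (eLpNorm_le_mul_eLpNorm_of_ae_le_mul (c := K)
          (g := fun x : ℝ => F (x + y * Complex.I)) (Eventually.of_forall fun x => ?_) 2)
          (mul_le_mul_right (hM y hy) _)
        rw [Real.norm_of_nonneg (by positivity)]
      refine le_trans (eLpNorm_mono_real fun x => ?_) ((eLpNorm_add_le (p := 2)
        ((aestronglyMeasurable_line hF.1 hy).norm.const_mul K) hindLp.1 (by norm_num)).trans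
          (add_le_add_left h1 _))
      simp only [Pi.add_apply]
      have hind0 : 0 ≤ ind x := Set.indicator_nonneg (fun _ _ => hB0) x
      rcases le_or_gt r ‖(x + y * Complex.I : ℂ) - z‖ with h2 | h2
      · have h3 : (x + y * Complex.I : ℂ) ≠ z := by
          intro h
          rw [h, sub_self, norm_zero] at h2
          linarith
        rw [hQF _ h3, norm_smul]
        have := mul_le_mul_of_nonneg_right (hψ _ h2) (norm_nonneg (F (x + y * Complex.I)))
        linarith
      · have h3 : x ∈ Metric.closedBall z.re r := by
          have h4 := (Complex.abs_re_le_norm ((x + y * Complex.I : ℂ) - z)).trans h2.le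
          simpa [Real.dist_eq] using h4
        have h4 : ind x = B := Set.indicator_of_mem h3 _
        rw [h4]
        have h5 := hB (x + y * Complex.I) (by rw [mem_closedBall_iff_norm]; exact h2.le)
        have : 0 ≤ K * ‖F (x + y * Complex.I)‖ := by positivity
        linarith
    refine ⟨(ENNReal.ofReal K * M + eLpNorm ind 2 volume).toNNReal, fun y hy => ?_⟩
    rw [ENNReal.coe_toNNReal (ENNReal.add_ne_top.2
      ⟨ENNReal.mul_ne_top ENNReal.ofReal_ne_top ENNReal.coe_ne_top, hindLp.2.ne⟩)]
    exact hbound y hy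
  · set L : ℝ := ‖z - ζ‖ * r⁻¹ * r⁻¹ with hL
    have hlim : Tendsto (fun y : ℝ => ENNReal.ofReal K *
          eLpNorm (fun x : ℝ => F (x + y * Complex.I) - f x) 2 volume +
        ENNReal.ofReal (y * L) * eLpNorm f 2 volume) (𝓝[>] 0) (𝓝 0) := by
      have h1 : Continuous fun y : ℝ => ENNReal.ofReal (y * L) :=
        ENNReal.continuous_ofReal.comp (by fun_prop)
      have h2 := (h1.tendsto 0).mono_left (nhdsWithin_le_nhds (s := Set.Ioi 0))
      have h3 := ENNReal.Tendsto.mul_const (b := eLpNorm f 2 volume) h2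
        (Or.inr (Lp.eLpNorm_ne_top f))
      have h4 := ENNReal.Tendsto.const_mul (a := ENNReal.ofReal K) hF.tendsto
        (Or.inr ENNReal.ofReal_ne_top)
      simpa using h4.add h3
    refine tendsto_of_tendsto_of_tendsto_of_le_of_le' tendsto_const_nhds hlim
      (Eventually.of_forall fun _ => zero_le) ?_
    filter_upwards [Ioo_mem_nhdsGT hr0] with y hy
    have hwz : ∀ x : ℝ, r ≤ ‖(x + y * Complex.I : ℂ) - z‖ := by
      intro x
      refine le_trans ?_ (Complex.abs_im_le_norm _)
      simp only [Complex.sub_im, Complex.add_im, Complex.ofReal_im, Complex.mul_im,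
        Complex.ofReal_re, Complex.I_im, Complex.I_re, mul_one, mul_zero, add_zero, zero_add]
      rw [abs_sub_comm]
      refine le_trans ?_ (le_abs_self _)
      linarith [hy.2]
    have hne : ∀ x : ℝ, (x + y * Complex.I : ℂ) - z ≠ 0 := fun x =>
      norm_pos_iff.1 (hr0.trans_le (hwz x))
    set A : ℝ → H := fun x => (1 + (z - ζ) * ((x + y * Complex.I : ℂ) - z)⁻¹) •
      (F (x + y * Complex.I) - f x) with hA
    set D : ℝ → H := fun x => ((1 + (z - ζ) * ((x + y * Complex.I : ℂ) - z)⁻¹) -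
      (1 + (z - ζ) * ((x : ℂ) - z)⁻¹)) • f x with hD
    have hcont : Continuous fun x : ℝ => (1 + (z - ζ) * ((x + y * Complex.I : ℂ) - z)⁻¹) :=
      continuous_const.add (continuous_const.mul
        ((by fun_prop : Continuous fun x : ℝ => (x + y * Complex.I : ℂ) - z).inv₀ hne))
    have hAm : AEStronglyMeasurable A volume := hcont.aestronglyMeasurable.smul
      ((aestronglyMeasurable_line hF.1 hy.1).sub (Lp.aestronglyMeasurable f))
    have hDm : AEStronglyMeasurable D volume :=
      (hcont.aestronglyMeasurable.sub hψm.aestronglyMeasurable).smul (Lp.aestronglyMeasurable f)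
    have hsplit : (fun x : ℝ => Q (x + y * Complex.I) - hq.toLp _ x) =ᵐ[volume] A + D := by
      filter_upwards [hq.coeFn_toLp] with x hx
      rw [hx, hQF _ (sub_ne_zero.1 (hne x)), Pi.add_apply, hA, hD]
      module
    rw [eLpNorm_congr_ae hsplit]
    refine (eLpNorm_add_le hAm hDm (by norm_num)).trans (add_le_add ?_ ?_)
    · refine eLpNorm_le_mul_eLpNorm_of_ae_le_mul (Eventually.of_forall fun x => ?_) _
      rw [hA, norm_smul]
      exact mul_le_mul_of_nonneg_right (hψ _ (hwz x)) (norm_nonneg _)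
    · refine eLpNorm_le_mul_eLpNorm_of_ae_le_mul (Eventually.of_forall fun x => ?_) _
      have h2 := sub_ne_zero_of_im_ne_zero hzne x
      have h1 := hne x
      have h3 : (1 + (z - ζ) * ((x + y * Complex.I : ℂ) - z)⁻¹) -
          (1 + (z - ζ) * ((x : ℂ) - z)⁻¹) = -(y * Complex.I) *
            ((z - ζ) * ((x + y * Complex.I : ℂ) - z)⁻¹ * ((x : ℂ) - z)⁻¹) := by
        field_simp
        ring
      rw [hD, norm_smul, h3, norm_mul, norm_mul, norm_mul, norm_neg, norm_mul, Complex.norm_I,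
        mul_one, Complex.norm_real, Real.norm_of_nonneg hy.1.le, norm_inv, norm_inv, hL]
      gcongr
      · exact hy.1.le
      · exact hwz x
      · exact hzt x

/-- **Cauchy's formula** at a zero of a Hardy function. -/
theorem IsHardyExtension.pairing_eq_zero_of_eq_zero [CompleteSpace H] {F : ℂ → H} {f : L2Space H}
    (hF : IsHardyExtension F f) {z : ℂ} (hz : 0 < z.im) (hFz : F z = 0) :
    pairing H (cauchyKernel z) f = 0 := by
  -- With the zero moved to -i, (t - z)⁻¹ f equals (t + i)⁻¹ q, a pairing with a kernel whose pole
  -- is in the lower half-plane.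
  obtain ⟨q, ⟨Q, hQ⟩, hq⟩ := hF.exists_div hz hFz (-Complex.I)
  have hi : (-Complex.I).im < 0 := by simp
  rw [← hQ.pairing_eq_zero hi, pairing_apply, pairing_apply]
  refine integral_congr_ae ?_
  filter_upwards [hq, coeFn_cauchyKernel hz.ne', coeFn_cauchyKernel hi.ne] with t h1 h2 h3
  rw [h1, h2, h3, smul_smul]
  congr 1
  have := sub_ne_zero_of_im_ne_zero hz.ne' t
  have := sub_ne_zero_of_im_ne_zero hi.ne t
  field_simp
  ring

/-- On the real line the two kernels multiply to |t - z|⁻², so the constant in Cauchy's formula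
comes from a norm computation, without residues. -/
theorem pairing_tensorL_conj [CompleteSpace H] {z : ℂ} (hz : 0 < z.im) (a : H) :
    pairing H (cauchyKernel z) (tensorL H (cauchyKernel (starRingEnd ℂ z)) a) =
      ((Real.pi / z.im : ℝ) : ℂ) • a := by
  have hz' : (starRingEnd ℂ z).im ≠ 0 := by simpa using hz.ne'
  have h1 := integral_norm_inv_sub_sq hz.ne'
  rw [abs_of_pos hz] at h1
  rw [pairing_apply, ← h1, ← integral_complex_ofReal, ← integral_smul_const]
  refine integral_congr_ae ?_
  filter_upwards [coeFn_tensorL (cauchyKernel (starRingEnd ℂ z)) a, coeFn_cauchyKernel hz.ne',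
    coeFn_cauchyKernel hz'] with t h2 h3 h4
  rw [h2, h3, h4, smul_smul]
  congr 1
  have h5 : (t : ℂ) - starRingEnd ℂ z = starRingEnd ℂ ((t : ℂ) - z) := by simp
  rw [h5, ← map_inv₀, Complex.mul_conj, Complex.normSq_eq_norm_sq]

/-- **Cauchy's formula** for Hardy functions. -/
theorem IsHardyExtension.pairing_cauchyKernel [CompleteSpace H] {F : ℂ → H} {f : L2Space H}
    (hF : IsHardyExtension F f) {z : ℂ} (hz : 0 < z.im) :
    pairing H (cauchyKernel z) f = (2 * Real.pi * Complex.I : ℂ) • F z := by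
  have hz' : (starRingEnd ℂ z).im < 0 := by simpa using hz
  have hzz : z - starRingEnd ℂ z = 2 * z.im * Complex.I := by
    rw [Complex.sub_conj]
    push_cast
    ring
  have him : (z.im : ℂ) ≠ 0 := by exact_mod_cast hz.ne'
  -- The multiple of the kernel is chosen to cancel the value of F at z.
  have hK := (isHardyExtension_cauchyKernel hz' (F z)).smul (-(z - starRingEnd ℂ z))
  have h1 := (hF.add hK).pairing_eq_zero_of_eq_zero hz (by
    have : z - starRingEnd ℂ z ≠ 0 := by
      rw [hzz]
      simp [him]
    simp only [Pi.add_apply, Pi.smul_apply, smul_smul]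
    rw [neg_mul, mul_inv_cancel₀ this]
    simp)
  rw [map_add, map_smul, pairing_tensorL_conj hz, add_eq_zero_iff_eq_neg] at h1
  rw [h1, smul_smul, hzz, ← neg_smul]
  congr 1
  push_cast
  field_simp

end

/-! ### Operators preserving the Hardy space -/

section

variable {H : Type*} [NormedAddCommGroup H] [InnerProductSpace ℂ H] [CompleteSpace H]

/-- Zeros of Hardy functions are preserved by operators that commute with modulations and preserve
the Hardy space. -/
theorem IsHardyExtension.apply_eq_zero {Y : L2Space H →L[ℂ] L2Space H}
    (hY : ∀ (h : ℝ) (f : L2Space H), Y (modulation h f) = modulation h (Y f))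
    (hYH : ∀ f ∈ hardySpace H, Y f ∈ hardySpace H) {F G : ℂ → H} {f : L2Space H}
    (hF : IsHardyExtension F f) (hG : IsHardyExtension G (Y f)) {z : ℂ} (hz : 0 < z.im)
    (hFz : F z = 0) : G z = 0 := by
  have hi : (-Complex.I).im < 0 := by simp
  obtain ⟨q, hqH, hq⟩ := hF.exists_div hz hFz (-Complex.I)
  obtain ⟨P, hP⟩ := hYH q hqH
  have hne := hz.ne'
  have hψ := ae_eq_smul_of_commute_modulation hY
    (ψ := fun t : ℝ => 1 + (z - -Complex.I) * ((t : ℂ) - z)⁻¹)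
    (continuous_const.add
      (continuous_const.mul (continuous_inv_sub hne))).aestronglyMeasurable
    (C := 1 + ‖z - -Complex.I‖ * |z.im|⁻¹) (fun t => by
      refine (norm_add_le _ _).trans ?_
      rw [norm_one, norm_mul]
      gcongr
      exact norm_inv_sub_le hne t) hq
  -- Y carries the bounded factor relating q to f, so (t - z)⁻¹ Yf = (t + i)⁻¹ Yq, and Yq is again
  -- Hardy.
  have h1 : pairing H (cauchyKernel z) (Y f) = pairing H (cauchyKernel (-Complex.I)) (Y q) := by
    rw [pairing_apply, pairing_apply]
    refine integral_congr_ae ?_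
    filter_upwards [hψ, coeFn_cauchyKernel hne, coeFn_cauchyKernel hi.ne] with t h1 h2 h3
    rw [h1, h2, h3, smul_smul]
    congr 1
    have := sub_ne_zero_of_im_ne_zero hne t
    have := sub_ne_zero_of_im_ne_zero hi.ne t
    field_simp
    ring
  rw [hG.pairing_cauchyKernel hz, hP.pairing_eq_zero hi] at h1
  exact (smul_eq_zero_iff_right (by simp [Real.pi_ne_zero])).1 h1

/-- The symbol at `z` of an operator on `L²(ℝ) ⊗ H` that preserves the Hardy space, computed with
the Hardy kernel with pole at `ζ`. -/
def hardySymbol (Y : L2Space H →L[ℂ] L2Space H) (ζ z : ℂ) : H →L[ℂ] H :=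
  ((2 * Real.pi * Complex.I)⁻¹ * (z - ζ)) •
    (pairing H (cauchyKernel z) ∘L Y ∘L tensorL H (cauchyKernel ζ))

/-- The variable z enters only through a scalar factor and the L²-analytic kernel, followed by
bounded linear maps; hence analyticity in operator norm. -/
theorem differentiableOn_hardySymbol (Y : L2Space H →L[ℂ] L2Space H) (ζ : ℂ) :
    DifferentiableOn ℂ (hardySymbol Y ζ) upperHalf := by
  intro z hz
  have hz : 0 < z.im := hz
  have h1 : DifferentiableAt ℂ (fun z => pairing H (cauchyKernel z)) z := by
    have h0 : DifferentiableAt ℂ (fun κ => pairing H κ) (cauchyKernel z) :=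
      (pairing H).differentiableAt
    exact DifferentiableAt.comp (G := L2Space H →L[ℂ] H) z h0
      (differentiableAt_cauchyKernel hz.ne')
  have h2 : DifferentiableAt ℂ (fun z => pairing H (cauchyKernel z) ∘L
      (Y ∘L tensorL H (cauchyKernel ζ))) z := h1.clm_comp (differentiableAt_const _)
  have h3 : DifferentiableAt ℂ (fun z : ℂ => (2 * Real.pi * Complex.I)⁻¹ * (z - ζ)) z := by
    fun_prop
  exact (h3.smul h2).differentiableWithinAt

/-- Every extension of the image of a Hardy function is obtained by applying the symbol. -/
theorem IsHardyExtension.apply_eq_hardySymbol {Y : L2Space H →L[ℂ] L2Space H}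
    (hY : ∀ (h : ℝ) (f : L2Space H), Y (modulation h f) = modulation h (Y f))
    (hYH : ∀ f ∈ hardySpace H, Y f ∈ hardySpace H) {F G : ℂ → H} {f : L2Space H}
    (hF : IsHardyExtension F f) (hG : IsHardyExtension G (Y f)) {z ζ : ℂ} (hz : 0 < z.im)
    (hζ : ζ.im < 0) : G z = hardySymbol Y ζ z (F z) := by
  have hzζ : z - ζ ≠ 0 := by
    intro h
    have := congrArg Complex.im h
    rw [Complex.sub_im, Complex.zero_im] at this
    linarith
  have hK := isHardyExtension_cauchyKernel hζ (F z)
  obtain ⟨P, hP⟩ := hYH _ ⟨_, hK⟩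
  -- Subtracting (z - ζ)(w - ζ)⁻¹ F(z) creates a zero at z, which the image inherits.
  have h1 := (hF.add (hK.smul (-(z - ζ)))).apply_eq_zero hY hYH
    (G := G + (-(z - ζ)) • P) (by
      rw [map_add, map_smul]
      exact hG.add (hP.smul _)) hz (by
      simp only [Pi.add_apply, Pi.smul_apply, smul_smul]
      rw [neg_mul, mul_inv_cancel₀ hzζ]
      simp)
  have h2 := hP.pairing_cauchyKernel hz
  have hpi : (2 * Real.pi * Complex.I : ℂ) ≠ 0 := by simp [Real.pi_ne_zero]
  rw [Pi.add_apply, Pi.smul_apply, neg_smul, add_neg_eq_zero] at h1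
  rw [h1, hardySymbol, smul_apply, ContinuousLinearMap.comp_apply,
    ContinuousLinearMap.comp_apply, h2, smul_smul]
  congr 1
  field_simp

/-- The Hardy function (z - ζ)(w - ζ)⁻¹ a has value a at z, and the value of its image there can be
computed with either pole. Thus the pole may be fixed for analyticity and vary with z for the norm
bound. -/
theorem hardySymbol_eq {Y : L2Space H →L[ℂ] L2Space H}
    (hY : ∀ (h : ℝ) (f : L2Space H), Y (modulation h f) = modulation h (Y f))
    (hYH : ∀ f ∈ hardySpace H, Y f ∈ hardySpace H) {z ζ ξ : ℂ} (hz : 0 < z.im)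
    (hζ : ζ.im < 0) (hξ : ξ.im < 0) : hardySymbol Y ζ z = hardySymbol Y ξ z := by
  ext a
  have hzζ : z - ζ ≠ 0 := by
    intro h
    have := congrArg Complex.im h
    rw [Complex.sub_im, Complex.zero_im] at this
    linarith
  have hK := (isHardyExtension_cauchyKernel hζ a).smul (z - ζ)
  obtain ⟨P, hP⟩ := hYH _ ⟨_, hK⟩
  have h1 := hK.apply_eq_hardySymbol hY hYH hP hz hζ
  rw [hK.apply_eq_hardySymbol hY hYH hP hz hξ] at h1
  simpa [hzζ] using h1.symm

/-- With the pole at the conjugate of z, both kernels have squared norm π / Im z, which the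
prefactor of modulus Im z / π cancels exactly. -/
theorem norm_hardySymbol_le {Y : L2Space H →L[ℂ] L2Space H}
    (hY : ∀ (h : ℝ) (f : L2Space H), Y (modulation h f) = modulation h (Y f))
    (hYH : ∀ f ∈ hardySpace H, Y f ∈ hardySpace H) {z ζ : ℂ} (hz : 0 < z.im)
    (hζ : ζ.im < 0) : ‖hardySymbol Y ζ z‖ ≤ ‖Y‖ := by
  have hz' : (starRingEnd ℂ z).im < 0 := by simpa using hz
  have h0 : ‖cauchyKernel (starRingEnd ℂ z)‖ = ‖cauchyKernel z‖ := by
    rw [← sq_eq_sq₀ (norm_nonneg _) (norm_nonneg _), norm_sq_cauchyKernel hz.ne',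
      norm_sq_cauchyKernel hz'.ne]
    simp
  have h1 := norm_sq_cauchyKernel hz.ne'
  rw [abs_of_pos hz] at h1
  rw [hardySymbol_eq hY hYH hz hζ hz']
  refine ContinuousLinearMap.opNorm_le_bound _ (norm_nonneg _) fun a => ?_
  have hc : ‖((2 * Real.pi * Complex.I)⁻¹ * (z - starRingEnd ℂ z) : ℂ)‖ = z.im / Real.pi := by
    have : ((2 * Real.pi * Complex.I)⁻¹ * (z - starRingEnd ℂ z) : ℂ) =
        ((z.im / Real.pi : ℝ) : ℂ) := by
      have : (Real.pi : ℂ) ≠ 0 := by exact_mod_cast Real.pi_ne_zero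
      rw [Complex.sub_conj]
      push_cast
      field_simp
    rw [this, Complex.norm_real, Real.norm_of_nonneg (by positivity)]
  rw [hardySymbol, smul_apply, norm_smul, hc, ContinuousLinearMap.comp_apply,
    ContinuousLinearMap.comp_apply]
  have h2 : ‖pairing H (cauchyKernel z) (Y (tensorL H (cauchyKernel (starRingEnd ℂ z)) a))‖ ≤
      ‖cauchyKernel z‖ * (‖Y‖ * (‖cauchyKernel z‖ * ‖a‖)) := by
    refine (norm_pairing_le _ _).trans ?_
    gcongr
    refine (Y.le_opNorm _).trans ?_
    gcongr
    exact (norm_tensorL_le _ _).trans_eq (by rw [h0])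
  calc _ ≤ z.im / Real.pi * (‖cauchyKernel z‖ * (‖Y‖ * (‖cauchyKernel z‖ * ‖a‖))) := by gcongr
    _ = z.im / Real.pi * ‖cauchyKernel z‖ ^ 2 * (‖Y‖ * ‖a‖) := by ring
    _ = ‖Y‖ * ‖a‖ := by
      rw [h1]
      field_simp

end

end

/-! ### Gluing the half-plane symbol to the boundary symbol -/

theorem mainTheorem10 {H : Type*} [NormedAddCommGroup H] [InnerProductSpace ℂ H] [CompleteSpace H]
    (X : L2Space H →L[ℂ] L2Space H)
    (hX : ∀ (h : ℝ) (f : L2Space H), X (translation h f) = translation h (X f))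
    (hXH : ∀ f ∈ hardySpace H, fourierU H (X ((fourierU H).symm f)) ∈ hardySpace H) :
    ∃ S : ℂ → (H →L[ℂ] H),
      DifferentiableOn ℂ S upperHalf ∧
      (∃ M : ℝ, ∀ z : ℂ, 0 ≤ z.im → ‖S z‖ ≤ M) ∧
      ∀ (F : ℂ → H) (f : L2Space H), IsHardyExtension F f →
        IsHardyExtension (fun z => S z (F z)) (fourierU H (X ((fourierU H).symm f))) ∧
        ∀ᵐ t : ℝ, (fourierU H (X ((fourierU H).symm f)) : L2Space H) t = S (t : ℂ) (f t) := by

  let Y : L2Space H →L[ℂ] L2Space H :=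
    ((fourierU H).toContinuousLinearEquiv : L2Space H →L[ℂ] L2Space H) ∘L X ∘L
      ((fourierU H).symm.toContinuousLinearEquiv : L2Space H →L[ℂ] L2Space H)
  have hYdef : ∀ f, Y f = fourierU H (X ((fourierU H).symm f)) := fun _ => rfl
  have hY : ∀ (h : ℝ) (f : L2Space H), Y (modulation h f) = modulation h (Y f) := by
    intro h f
    have h1 : (fourierU H).symm (modulation h f) = translation (-h) ((fourierU H).symm f) := by
      rw [LinearIsometryEquiv.symm_apply_eq, fourierU_translation, neg_neg,
        LinearIsometryEquiv.apply_symm_apply]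
    rw [hYdef, hYdef, h1, hX, fourierU_translation, neg_neg]
  have hYH : ∀ f ∈ hardySpace H, Y f ∈ hardySpace H := hXH
  obtain ⟨S, hS, hYS⟩ := exists_multiplier_of_commute_modulation hY
  have hi : (-Complex.I).im < 0 := by simp
  -- Any fixed pole in the lower half-plane would serve in place of -i. Below the real axis the
  -- value is a mere default.
  refine ⟨fun z => if 0 < z.im then hardySymbol Y (-Complex.I) z else S z.re, ?_,
    ⟨‖Y‖, fun z _ => ?_⟩, fun F f hF => ⟨?_, ?_⟩⟩
  · exact (differentiableOn_hardySymbol Y (-Complex.I)).congr fun z hz => if_pos hz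
  · simp only
    split_ifs with hz
    · exact norm_hardySymbol_le hY hYH hz hi
    · exact hS z.re
  · obtain ⟨G, hG⟩ := hYH f ⟨F, hF⟩
    -- On the half-plane the product is the given Hardy extension G of the image, so the growth
    -- bound and the boundary limit transfer from G.
    have hGF : ∀ z ∈ upperHalf,
        (if 0 < z.im then hardySymbol Y (-Complex.I) z else S z.re) (F z) = G z := by
      intro z hz
      have hz : 0 < z.im := hz
      rw [if_pos hz]
      exact (hF.apply_eq_hardySymbol hY hYH hG hz hi).symm
    obtain ⟨M, hM⟩ := hG.bounded
    refine ⟨hG.1.congr hGF, ⟨M, fun y hy => ?_⟩, hG.tendsto.congr' ?_⟩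
    · simp only [hGF _ (line_mem_upperHalf _ hy)]
      exact hM y hy
    · filter_upwards [self_mem_nhdsWithin] with y hy
      simp only [hGF _ (line_mem_upperHalf _ hy)]
      rfl
  · filter_upwards [hYS f] with t ht
    rw [← hYdef, ht]
    simp
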